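/- A metrized graph $\Gamma$ is a connected space obtained from finitely many segments $[0,L_e]$, $L_e>0$, by gluing along finitely many points, i.e. a finite connected graph with parametrized edges (multiple edges and self-loops allowed); $dx$ denotes the length measure on it. For $y,z\in\Gamma$ let $x\mapsto j_z(x,y)$ be the voltage function: the unique continuous function on $\Gamma$, affine in the parameter off a finite set of points, that vanishes at $x=z$ and satisfies $\Delta_x j_z(x,y)=\delta_y(x)-\delta_z(x)$, where $\Delta f=-f''(x)\,dx-\sum_{p}\big[\sum_{\vec v\text{ at }p}d_{\vec v}f(p)\big]\delta_p$, the inner sum being over the directions emanating from $p$. Let $r(x,y)=j_x(y,y)$ be the resistance function. There is a unique real-valued signed Borel measure $\mu$ on $\Gamma$ with $\mu(\Gamma)=1$ (the canonical measure) such that $\int_\Gamma j_\zeta(x,x)\,d\mu(\zeta)$ does not depend on $x\in\Gamma$; the tau constant is $$\tau(\Gamma)=\frac12\int_\Gamma j_\zeta(x,x)\,d\mu(\zeta).$$ For $p,q\in\Gamma$ put $$A_{p,q,\Gamma}=\int_\Gamma j_x(p,q)\Big(\frac{d}{dx}j_p(x,q)\Big)^2dx .$$ Let $\Gamma_1$ and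 $\Gamma_2$ be metrized graphs with resistance functions $r_1$ and $r_2$, let $p\ne q$ be two distinct points of $\Gamma_1$ and also of $\Gamma_2$, and let $\Gamma_1\cup\Gamma_2$ be the metrized graph obtained by gluing $\Gamma_1$ and $\Gamma_2$ along $p$ and $q$ (identifying $p\in\Gamma_1$ with $p\in\Gamma_2$ and $q\in\Gamma_1$ with $q\in\Gamma_2$), so that $\Gamma_1\cap\Gamma_2=\{p,q\}$. Then $$\tau(\Gamma_1\cup\Gamma_2)=\tau(\Gamma_1)+\tau(\Gamma_2)-\frac{r_1(p,q)+r_2(p,q)}{6}+\frac{A_{p,q,\Gamma_1}+A_{p,q,\Gamma_2}}{r_1(p,q)+r_2(p,q)} .$$ -/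

import Mathlib

open MeasureTheory Filter Topology

universe u

/-- A metrized graph, presented as the space `Point` obtained from finitely many closed segments
`[0, len e]` by gluing along finitely many points, the result being connected.

The map `proj` sends the point with parameter `t` on the segment `e` to the corresponding point of
the graph. No vertex set is singled out: any finite set of points that contains the ends of the
segments and the points at which gluing takes place may serve as one, and cutting the segments
there gives the edges, with their parametrizations. A finite connected graph with parametrized
edges (multiple edges and self-loops allowed) is the case in which only ends are glued. -/
structure MetrizedGraph where
  /-- the index set of the segments -/
  Edge : Type u
  [fintypeEdge : Fintype Edge]
  /-- the lengths of the segments -/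
  len : Edge → ℝ
  len_pos : ∀ e, 0 < len e
  /-- the points of the graph -/
  Point : Type u
  /-- the gluing map -/
  proj : (Σ e, Set.Icc (0 : ℝ) (len e)) → Point
  proj_surjective : Function.Surjective proj
  finite_glued : {a | ∃ b, b ≠ a ∧ proj b = proj a}.Finite
  connectedSpace : @ConnectedSpace Point (TopologicalSpace.coinduced proj inferInstance)

attribute [instance] MetrizedGraph.fintypeEdge

noncomputable section

namespace MetrizedGraph

/-- The quotient topology. -/
instance (Γ : MetrizedGraph.{u}) : TopologicalSpace Γ.Point :=
  TopologicalSpace.coinduced Γ.proj inferInstance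

instance (Γ : MetrizedGraph.{u}) : ConnectedSpace Γ.Point := Γ.connectedSpace

instance (Γ : MetrizedGraph.{u}) : MeasurableSpace Γ.Point := borel Γ.Point

instance (Γ : MetrizedGraph.{u}) : BorelSpace Γ.Point := ⟨rfl⟩

/-- The parametrization `t ↦ path e t`, `0 ≤ t ≤ len e`, of the segment `e` (extended to all real
`t` by constants, which is only for convenience). -/
def path (Γ : MetrizedGraph.{u}) (e : Γ.Edge) (t : ℝ) : Γ.Point :=
  Γ.proj ⟨e, Set.projIcc 0 (Γ.len e) (Γ.len_pos e).le t⟩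

/-- The sum, over all directions emanating from the point `x`, of the directional derivatives
of `f` at `x`. A segment `e` contributes a forward direction for each `t ∈ [0, len e)` and a backward
direction for each `t ∈ (0, len e]` with `path e t = x`. -/
def slopeSum (Γ : MetrizedGraph.{u}) (f : Γ.Point → ℝ) (x : Γ.Point) : ℝ :=
  ∑ e, ((∑ᶠ t ∈ {t | t ∈ Set.Ico 0 (Γ.len e) ∧ Γ.path e t = x},
          derivWithin (fun s => f (Γ.path e s)) (Set.Ici t) t)
      + ∑ᶠ t ∈ {t | t ∈ Set.Ioc 0 (Γ.len e) ∧ Γ.path e t = x},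
          -derivWithin (fun s => f (Γ.path e s)) (Set.Iic t) t)

open Classical in
/-- `f` is the voltage on `Γ`, viewed as a resistive circuit whose resistances are the lengths, when
unit current enters at `y` and exits at `z`, with reference voltage `0` at `z`. That is, `f` is the
solution of `Δ f = δ_y - δ_z`, `f z = 0`, where `Δ f = -f'' dx - ∑ₓ (slopeSum f x) δₓ`:
`f` is continuous, `f'' = 0` (`f` is locally affine) off a finite set of points, and the outgoing
slopes sum to `0` at every point, except for a deficit of `1` at `y` and an excess of `1` at `z`. -/
structure IsVoltage (Γ : MetrizedGraph.{u}) (z y : Γ.Point) (f : Γ.Point → ℝ) : Prop where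
  continuous : Continuous f
  locally_affine : ∃ S : Set Γ.Point, S.Finite ∧
    ∀ e, ∀ t ∈ Set.Ioo 0 (Γ.len e), Γ.path e t ∉ S →
      ∃ a b : ℝ, ∀ᶠ s in 𝓝 t, f (Γ.path e s) = a + b * s
  slopeSum_eq : ∀ x, Γ.slopeSum f x = (if x = z then 1 else 0) - (if x = y then 1 else 0)
  ground : f z = 0

open Classical in
/-- The voltage function `j_z(x, y)`. -/
def voltage (Γ : MetrizedGraph.{u}) (z x y : Γ.Point) : ℝ :=
  if h : ∃ f, Γ.IsVoltage z y f then h.choose x else 0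

/-- The (effective) resistance function `r(x, y) = j_x(y, y)`. -/
def resistance (Γ : MetrizedGraph.{u}) (x y : Γ.Point) : ℝ := Γ.voltage x y y

/-- `j_μ(x, y) = ∫ j_ζ(x, y) dμ(ζ)` for a signed Borel measure `μ`. -/
def measureVoltage (Γ : MetrizedGraph.{u}) (μ : SignedMeasure Γ.Point) (x y : Γ.Point) : ℝ :=
  ∫ᵛ ζ, Γ.voltage ζ x y ∂•μ

/-- `μ` is a canonical measure: a signed Borel measure of total mass `1` for which `j_μ(x, x)` is
constant on `Γ`. -/
def IsCanonicalMeasure (Γ : MetrizedGraph.{u}) (μ : SignedMeasure Γ.Point) : Prop :=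
  μ Set.univ = 1 ∧ ∀ x x', Γ.measureVoltage μ x x = Γ.measureVoltage μ x' x'

open Classical in
/-- The tau constant: the constant value of `j_μ(x, x) / 2`, where `μ` is the canonical measure. -/
def tau (Γ : MetrizedGraph.{u}) : ℝ :=
  if h : ∃ c, ∃ μ, Γ.IsCanonicalMeasure μ ∧ ∀ x, 1 / 2 * Γ.measureVoltage μ x x = c
  then h.choose else 0

/-- `A_{p,q,Γ} = ∫_Γ j_x(p, q) (d/dx j_p(x, q))² dx`. -/
def A (Γ : MetrizedGraph.{u}) (p q : Γ.Point) : ℝ :=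
  ∑ e, ∫ t in (0 : ℝ)..Γ.len e,
    Γ.voltage (Γ.path e t) p q * deriv (fun s => Γ.voltage p (Γ.path e s) q) t ^ 2

lemma finite_fiber (Γ : MetrizedGraph.{u}) (x : Γ.Point) : {a | Γ.proj a = x}.Finite := by
  by_cases h : ({a | Γ.proj a = x} : Set _).Subsingleton
  · exact h.finite
  · refine Γ.finite_glued.subset fun a ha => ?_
    by_contra hc
    refine h fun b hb c hc' => ?_
    have key : ∀ d, Γ.proj d = x → d = a := fun d hd => by
      by_contra hne
      exact hc ⟨d, hne, hd.trans (Eq.symm ha)⟩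
    rw [key b hb, key c hc']

lemma continuous_proj (Γ : MetrizedGraph.{u}) : Continuous Γ.proj := continuous_coinduced_rng

section Union

variable (Γ₁ Γ₂ : MetrizedGraph.{u}) {p₁ q₁ : Γ₁.Point} {p₂ q₂ : Γ₂.Point}

/-- The equivalence relation on the disjoint union of `Γ₁` and `Γ₂` that identifies `p₁` with `p₂`,
and `q₁` with `q₂`, and nothing else. -/
def unionSetoid (h₁ : p₁ ≠ q₁) (h₂ : p₂ ≠ q₂) : Setoid (Γ₁.Point ⊕ Γ₂.Point) where
  r a b := a = b ∨ (a = .inl p₁ ∧ b = .inr p₂) ∨ (a = .inr p₂ ∧ b = .inl p₁) ∨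
    (a = .inl q₁ ∧ b = .inr q₂) ∨ (a = .inr q₂ ∧ b = .inl q₁)
  iseqv := by
    refine ⟨fun _ => .inl rfl, ?_, ?_⟩
    · grind
    · grind

/-- The gluing map of the union of `Γ₁` and `Γ₂` along two points. -/
def unionProj (h₁ : p₁ ≠ q₁) (h₂ : p₂ ≠ q₂) :
    (Σ e : Γ₁.Edge ⊕ Γ₂.Edge, Set.Icc (0 : ℝ) (Sum.elim Γ₁.len Γ₂.len e)) →
      Quotient (unionSetoid Γ₁ Γ₂ h₁ h₂)
  | ⟨.inl e, t⟩ => ⟦.inl (Γ₁.proj ⟨e, t⟩)⟧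
  | ⟨.inr e, t⟩ => ⟦.inr (Γ₂.proj ⟨e, t⟩)⟧

/-- The union `Γ₁ ∪ Γ₂` along two points: the graph obtained from the disjoint union of `Γ₁` and `Γ₂`
by identifying `p₁` with `p₂` and `q₁` with `q₂`. -/
def union (h₁ : p₁ ≠ q₁) (h₂ : p₂ ≠ q₂) : MetrizedGraph.{u} where
  Edge := Γ₁.Edge ⊕ Γ₂.Edge
  len := Sum.elim Γ₁.len Γ₂.len
  len_pos := by
    rintro (e | e)
    · exact Γ₁.len_pos e
    · exact Γ₂.len_pos e
  Point := Quotient (unionSetoid Γ₁ Γ₂ h₁ h₂)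
  proj := unionProj Γ₁ Γ₂ h₁ h₂
  proj_surjective := by
    intro x
    induction x using Quotient.inductionOn with
    | h x =>
      rcases x with x | x
      · obtain ⟨⟨e, t⟩, rfl⟩ := Γ₁.proj_surjective x
        exact ⟨⟨.inl e, t⟩, rfl⟩
      · obtain ⟨⟨e, t⟩, rfl⟩ := Γ₂.proj_surjective x
        exact ⟨⟨.inr e, t⟩, rfl⟩
  finite_glued := by
    let i₁ : (Σ e, Set.Icc (0 : ℝ) (Γ₁.len e)) →
        (Σ e : Γ₁.Edge ⊕ Γ₂.Edge, Set.Icc (0 : ℝ) (Sum.elim Γ₁.len Γ₂.len e)) :=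
      fun a => ⟨.inl a.1, a.2⟩
    let i₂ : (Σ e, Set.Icc (0 : ℝ) (Γ₂.len e)) →
        (Σ e : Γ₁.Edge ⊕ Γ₂.Edge, Set.Icc (0 : ℝ) (Sum.elim Γ₁.len Γ₂.len e)) :=
      fun a => ⟨.inr a.1, a.2⟩
    refine (((Γ₁.finite_glued.union ((Γ₁.finite_fiber p₁).union (Γ₁.finite_fiber q₁))).image
      i₁).union ((Γ₂.finite_glued.union ((Γ₂.finite_fiber p₂).union
      (Γ₂.finite_fiber q₂))).image i₂)).subset ?_
    rintro ⟨a, s⟩ ⟨⟨b, t⟩, hne, hab⟩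
    rcases a with a | a <;> rcases b with b | b
    · refine .inl ⟨⟨a, s⟩, .inl ⟨⟨b, t⟩, fun h => hne (congrArg i₁ h), ?_⟩, rfl⟩
      rcases Quotient.exact hab with h | h | h | h | h <;> simp_all
    · refine .inl ⟨⟨a, s⟩, .inr ?_, rfl⟩
      rcases Quotient.exact hab with h | h | h | h | h <;> simp_all
    · refine .inr ⟨⟨a, s⟩, .inr ?_, rfl⟩
      rcases Quotient.exact hab with h | h | h | h | h <;> simp_all
    · refine .inr ⟨⟨a, s⟩, .inl ⟨⟨b, t⟩, fun h => hne (congrArg i₂ h), ?_⟩, rfl⟩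
      rcases Quotient.exact hab with h | h | h | h | h <;> simp_all
  connectedSpace := by
    let _ : TopologicalSpace (Quotient (unionSetoid Γ₁ Γ₂ h₁ h₂)) :=
      TopologicalSpace.coinduced (unionProj Γ₁ Γ₂ h₁ h₂) inferInstance
    have hπ : Continuous (unionProj Γ₁ Γ₂ h₁ h₂) := continuous_coinduced_rng
    let k₁ : Γ₁.Point → Quotient (unionSetoid Γ₁ Γ₂ h₁ h₂) := fun x => ⟦.inl x⟧
    let k₂ : Γ₂.Point → Quotient (unionSetoid Γ₁ Γ₂ h₁ h₂) := fun x => ⟦.inr x⟧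
    have hk₁ : Continuous k₁ := continuous_coinduced_dom.2 <| continuous_sigma fun e =>
      hπ.comp (continuous_sigmaMk (σ := fun e : Γ₁.Edge ⊕ Γ₂.Edge =>
        Set.Icc (0 : ℝ) (Sum.elim Γ₁.len Γ₂.len e)) (i := .inl e))
    have hk₂ : Continuous k₂ := continuous_coinduced_dom.2 <| continuous_sigma fun e =>
      hπ.comp (continuous_sigmaMk (σ := fun e : Γ₁.Edge ⊕ Γ₂.Edge =>
        Set.Icc (0 : ℝ) (Sum.elim Γ₁.len Γ₂.len e)) (i := .inr e))
    have hpp : k₁ p₁ = k₂ p₂ := Quotient.sound (.inr (.inl ⟨rfl, rfl⟩))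
    have hU : Set.range k₁ ∪ Set.range k₂ = Set.univ := by
      refine Set.eq_univ_of_forall fun x => ?_
      induction x using Quotient.inductionOn with
      | h x =>
        rcases x with x | x
        · exact .inl ⟨x, rfl⟩
        · exact .inr ⟨x, rfl⟩
    refine connectedSpace_iff_univ.2 (hU ▸ IsConnected.union
      ⟨k₁ p₁, ⟨p₁, rfl⟩, ⟨p₂, hpp.symm⟩⟩ (isConnected_range hk₁) (isConnected_range hk₂))

end Union

end MetrizedGraph

end

/-!
On the algebra of continuous, piecewise polynomial functions consider the energy pairing
`E(f, g) = ∫ f' g' dx`. By Green's identity the voltage function `j_z(·, y)` is characterised by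
`E(j_z(·, y), g) = g y - g z`, and `δ_y + ½ Δ r(·, y)` is a canonical measure for every point `y`.
By Fubini's theorem any canonical measure gives the same constant, so that
`4 τ(Γ) = E(r(·, y), r(·, y))`.

Take the base point `y = p` in `Γ₁ ∪ Γ₂`, and let `R = r₁(p, q) + r₂(p, q)`. On `Γᵢ` the resistance
to `p` in the union is `rᵢ(p, ·) - u² / R`, where `u = j_p(·, q)` is the voltage function of `Γᵢ`:
the other graph acts as a single resistor between `p` and `q`. The energy of the union is the sum of
the energies of the parts, and expanding the square reduces the formula to the energies of `u²` with
itself and with `rᵢ(p, ·)`, which follow from the product rule and `E(u, g) = g q - g p`.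
-/

noncomputable section

section RealLine

lemma interval_induction {α : Type*} [LinearOrder α] (T : Finset α) {Q : α → α → Prop} {a b : α}
    (hab : a < b)
    (gap : ∀ c d, a ≤ c → c < d → d ≤ b → (∀ t ∈ T, t ∉ Set.Ioo c d) → Q c d)
    (concat : ∀ c m d, a ≤ c → c < m → m < d → d ≤ b → m ∈ T → Q c m → Q m d → Q c d) :
    Q a b := by
  induction T using Finset.induction_on generalizing a b with
  | empty => exact gap a b le_rfl hab le_rfl (by simp)
  | insert t T _ ih =>
    have avoiding : ∀ a' b', a ≤ a' → a' < b' → b' ≤ b → t ∉ Set.Ioo a' b' → Q a' b' := by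
      intro a' b' ha hab' hb ht
      refine ih hab' (fun c d hc hcd hd hT => gap c d (ha.trans hc) hcd (hd.trans hb) ?_)
        fun c m d hc hcm hmd hd hm =>
          concat c m d (ha.trans hc) hcm hmd (hd.trans hb) (Finset.mem_insert_of_mem hm)
      exact (Finset.forall_mem_insert t T _).2
        ⟨fun h => ht ⟨hc.trans_lt h.1, h.2.trans_le hd⟩, hT⟩
    by_cases ht : t ∈ Set.Ioo a b
    · exact concat a t b le_rfl ht.1 ht.2 le_rfl (Finset.mem_insert_self t T)
        (avoiding a t le_rfl ht.1 ht.2.le fun h => h.2.false)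
        (avoiding t b ht.1.le ht.2 le_rfl fun h => h.1.false)
    · exact avoiding a b le_rfl hab le_rfl ht

lemma sum_filter_mem_union {α M : Type*} [AddCommMonoid M] (T : Finset α)
    {s t : Set α} [DecidablePred (· ∈ s)] [DecidablePred (· ∈ t)] [DecidablePred (· ∈ s ∪ t)]
    (h : Disjoint s t) (F : α → M) :
    ∑ x ∈ T with x ∈ s ∪ t, F x = ∑ x ∈ T with x ∈ s, F x + ∑ x ∈ T with x ∈ t, F x := by
  classical
  rw [← Finset.sum_union (Finset.disjoint_filter.2 fun _ _ hs ht => h.le_bot ⟨hs, ht⟩),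
    ← Finset.filter_or]
  simp only [Set.mem_union]

open Polynomial

/-- The function `φ` agrees with a polynomial near `t`. -/
def PolyAt (φ : ℝ → ℝ) (t : ℝ) : Prop := ∃ P : ℝ[X], ∀ᶠ s in 𝓝 t, φ s = P.eval s

/-- The function `φ` is affine near `t`. -/
def AffineAt (φ : ℝ → ℝ) (t : ℝ) : Prop := ∃ a b : ℝ, ∀ᶠ s in 𝓝 t, φ s = a + b * s

/-- The function `φ` is continuous, and it is locally polynomial on `(a, b)` off the finite
set `T`. -/
structure PiecewisePoly (T : Finset ℝ) (a b : ℝ) (φ : ℝ → ℝ) : Prop where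
  continuous : Continuous φ
  polyAt : ∀ t ∈ Set.Ioo a b, t ∉ T → PolyAt φ t

variable {φ ψ : ℝ → ℝ} {t a b : ℝ}

section Local

lemma affineAt_const (c t : ℝ) : AffineAt (fun _ => c) t := ⟨c, 0, by simp⟩

lemma AffineAt.add (hφ : AffineAt φ t) (hψ : AffineAt ψ t) : AffineAt (φ + ψ) t := by
  obtain ⟨a, b, hφ⟩ := hφ
  obtain ⟨c, d, hψ⟩ := hψ
  refine ⟨a + c, b + d, ?_⟩
  filter_upwards [hφ, hψ] with s hs hs'
  rw [Pi.add_apply, hs, hs']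
  ring

lemma AffineAt.const_smul (c : ℝ) (hφ : AffineAt φ t) : AffineAt (c • φ) t := by
  obtain ⟨a, b, hφ⟩ := hφ
  refine ⟨c * a, c * b, ?_⟩
  filter_upwards [hφ] with s hs
  rw [Pi.smul_apply, hs, smul_eq_mul]
  ring

lemma AffineAt.polyAt (hφ : AffineAt φ t) : PolyAt φ t := by
  obtain ⟨a, b, hφ⟩ := hφ
  exact ⟨C a + C b * X, by simpa using hφ⟩

lemma PolyAt.add (hφ : PolyAt φ t) (hψ : PolyAt ψ t) : PolyAt (φ + ψ) t := by
  obtain ⟨P, hP⟩ := hφ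
  obtain ⟨Q, hQ⟩ := hψ
  refine ⟨P + Q, ?_⟩
  filter_upwards [hP, hQ] with s hs hs'
  rw [Pi.add_apply, hs, hs', eval_add]

lemma PolyAt.mul (hφ : PolyAt φ t) (hψ : PolyAt ψ t) : PolyAt (φ * ψ) t := by
  obtain ⟨P, hP⟩ := hφ
  obtain ⟨Q, hQ⟩ := hψ
  refine ⟨P * Q, ?_⟩
  filter_upwards [hP, hQ] with s hs hs'
  rw [Pi.mul_apply, hs, hs', eval_mul]

lemma PolyAt.differentiableAt (hφ : PolyAt φ t) : DifferentiableAt ℝ φ t := by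
  obtain ⟨P, hP⟩ := hφ
  exact P.differentiableAt.congr_of_eventuallyEq hP

lemma AffineAt.deriv_deriv (hφ : AffineAt φ t) : deriv (deriv φ) t = 0 := by
  obtain ⟨a, b, hφ⟩ := hφ
  have hderiv : deriv φ =ᶠ[𝓝 t] fun _ => b := by
    filter_upwards [hφ.eventually_nhds] with s hs
    rw [EventuallyEq.deriv_eq hs]
    simp
  rw [hderiv.deriv_eq, deriv_const]

lemma eq_of_eventually_eval_eq {P Q : ℝ[X]} (h : ∀ᶠ s in 𝓝 t, P.eval s = Q.eval s) : P = Q :=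
  eq_of_infinite_eval_eq P Q (infinite_of_mem_nhds t h)

/-- The sets on which a function agrees locally with a given polynomial are open and, for distinct
polynomials, disjoint; as the interval is connected, it meets only one of them. -/
lemma exists_eqOn_polynomial_of_forall_polyAt (hab : a < b) (hφ : ContinuousOn φ (Set.Icc a b))
    (h : ∀ s ∈ Set.Ioo a b, PolyAt φ s) :
    ∃ P : ℝ[X], Set.EqOn φ (fun s => P.eval s) (Set.Icc a b) := by
  let agree (P : ℝ[X]) : Set ℝ := {t | ∀ᶠ s in 𝓝 t, φ s = P.eval s}
  have isOpen_agree (P : ℝ[X]) : IsOpen (agree P) := isOpen_setOfPred_eventually_nhds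
  obtain ⟨m, hm⟩ := Set.nonempty_Ioo.2 hab
  obtain ⟨P, hP⟩ := h m hm
  have disjoint_agree : Disjoint (agree P) (⋃ Q ∈ {Q | Q ≠ P}, agree Q) := by
    refine Set.disjoint_iUnion₂_right.2 fun Q hQ => Set.disjoint_left.2 fun s hsP hsQ => hQ ?_
    refine eq_of_eventually_eval_eq (t := s) ?_
    filter_upwards [hsP, hsQ] with r hrP hrQ
    rw [← hrQ, hrP]
  have Ioo_subset : Set.Ioo a b ⊆ agree P ∪ ⋃ Q ∈ {Q | Q ≠ P}, agree Q := by
    intro s hs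
    obtain ⟨Q, hQ⟩ := h s hs
    by_cases hQP : Q = P
    · exact .inl (hQP ▸ hQ)
    · exact .inr (Set.mem_biUnion hQP hQ)
  have Ioo_subset_agree : Set.Ioo a b ⊆ agree P := isPreconnected_Ioo.subset_left_of_subset_union
    (isOpen_agree P) (isOpen_biUnion fun Q _ => isOpen_agree Q) disjoint_agree Ioo_subset
    ⟨m, hm, hP⟩
  have heq : Set.EqOn φ (fun s => P.eval s) (Set.Ioo a b) := fun s hs =>
    (show ∀ᶠ r in 𝓝 s, φ r = P.eval r from Ioo_subset_agree hs).self_of_nhds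
  exact ⟨P, heq.of_subset_closure hφ P.continuousOn Set.Ioo_subset_Icc_self
    (closure_Ioo hab.ne).ge⟩

lemma exists_eqOn_affine_of_forall_affineAt (hab : a < b) (hφ : ContinuousOn φ (Set.Icc a b))
    (h : ∀ s ∈ Set.Ioo a b, AffineAt φ s) :
    ∃ c d : ℝ, Set.EqOn φ (fun s => (C c + C d * X : ℝ[X]).eval s) (Set.Icc a b) := by
  obtain ⟨P, hP⟩ := exists_eqOn_polynomial_of_forall_polyAt hab hφ fun s hs => (h s hs).polyAt
  obtain ⟨m, hm⟩ := Set.nonempty_Ioo.2 hab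
  obtain ⟨c, d, hcd⟩ := h m hm
  have hPcd : P = C c + C d * X := by
    refine eq_of_eventually_eval_eq (t := m) ?_
    filter_upwards [hcd, Icc_mem_nhds hm.1 hm.2] with s hs hs'
    simp [← hs, hP hs']
  exact ⟨c, d, hPcd ▸ hP⟩

end Local

section Polynomial

variable {P : ℝ[X]}

lemma polyAt_of_eqOn_polynomial (h : Set.EqOn φ (fun s => P.eval s) (Set.Icc a b))
    (ht : t ∈ Set.Ioo a b) : PolyAt φ t :=
  ⟨P, h.eventuallyEq_of_mem (Icc_mem_nhds ht.1 ht.2)⟩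

lemma deriv_eqOn_of_eqOn_polynomial (h : Set.EqOn φ (fun s => P.eval s) (Set.Icc a b)) :
    Set.EqOn (deriv φ) (fun s => P.derivative.eval s) (Set.Ioo a b) := fun t ht => by
  rw [(h.eventuallyEq_of_mem (Icc_mem_nhds ht.1 ht.2)).deriv_eq, Polynomial.deriv]

lemma deriv_deriv_eqOn_of_eqOn_polynomial
    (h : Set.EqOn φ (fun s => P.eval s) (Set.Icc a b)) :
    Set.EqOn (deriv (deriv φ)) (fun s => P.derivative.derivative.eval s) (Set.Ioo a b) :=
  fun t ht => by
    rw [((deriv_eqOn_of_eqOn_polynomial h).eventuallyEq_of_mem (Ioo_mem_nhds ht.1 ht.2)).deriv_eq,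
      Polynomial.deriv]

lemma derivWithin_Ici_of_eqOn_polynomial (hab : a < b)
    (h : Set.EqOn φ (fun s => P.eval s) (Set.Icc a b)) :
    derivWithin φ (Set.Ici a) a = P.derivative.eval a := by
  rw [(h.eventuallyEq_of_mem (Icc_mem_nhdsGE hab)).derivWithin_eq (h (Set.left_mem_Icc.2 hab.le)),
    P.derivWithin (uniqueDiffWithinAt_Ici a)]

lemma derivWithin_Iic_of_eqOn_polynomial (hab : a < b)
    (h : Set.EqOn φ (fun s => P.eval s) (Set.Icc a b)) :
    derivWithin φ (Set.Iic b) b = P.derivative.eval b := by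
  rw [(h.eventuallyEq_of_mem (Icc_mem_nhdsLE hab)).derivWithin_eq (h (Set.right_mem_Icc.2 hab.le)),
    P.derivWithin (uniqueDiffWithinAt_Iic b)]

end Polynomial

lemma mul_sub_eq_of_forall_affineAt_of_ne (hφ : ContinuousOn φ (Set.Icc a b))
    (ht : t ∈ Set.Icc a b) (h : ∀ s ∈ Set.Ioo a b, s ≠ t → AffineAt φ s) :
    φ t * (b - a) = φ a * (b - t) + φ b * (t - a) -
      (derivWithin φ (Set.Ici t) t - derivWithin φ (Set.Iic t) t) * ((t - a) * (b - t)) := by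
  rcases ht.1.eq_or_lt with rfl | hat
  · ring
  rcases ht.2.eq_or_lt with rfl | htb
  · ring
  obtain ⟨c, d, hleft⟩ := exists_eqOn_affine_of_forall_affineAt hat
    (hφ.mono (Set.Icc_subset_Icc_right htb.le)) fun s hs => h s ⟨hs.1, hs.2.trans htb⟩ hs.2.ne
  obtain ⟨c', d', hright⟩ := exists_eqOn_affine_of_forall_affineAt htb
    (hφ.mono (Set.Icc_subset_Icc_left hat.le)) fun s hs => h s ⟨hat.trans hs.1, hs.2⟩ hs.1.ne'
  have hφa := hleft (Set.left_mem_Icc.2 hat.le)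
  have hφt := hleft (Set.right_mem_Icc.2 hat.le)
  have hφt' := hright (Set.left_mem_Icc.2 htb.le)
  have hφb := hright (Set.right_mem_Icc.2 htb.le)
  have hslope := derivWithin_Iic_of_eqOn_polynomial hat hleft
  have hslope' := derivWithin_Ici_of_eqOn_polynomial htb hright
  simp only [derivative_add, derivative_C, derivative_C_mul, derivative_X, eval_add, eval_mul,
    eval_C, eval_X, mul_one, zero_add] at hφa hφt hφt' hφb hslope hslope'
  rw [hslope, hslope', hφa, hφb]
  linear_combination (b - t) * hφt + (t - a) * hφt'

lemma exists_piecewiseAffine_interpolation (T : Finset ℝ) (w : ℝ → ℝ) :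
    ∃ φ : ℝ → ℝ, Continuous φ ∧ (∀ t ∈ T, φ t = w t) ∧ ∀ t ∉ T, AffineAt φ t := by
  induction T using Finset.induction_on_max with
  | empty => exact ⟨fun _ => 0, continuous_const, by simp, fun t _ => affineAt_const 0 t⟩
  | insert m T hm ih =>
    obtain ⟨φ, hcont, hφ, haff⟩ := ih
    rcases T.eq_empty_or_nonempty with rfl | hne
    · exact ⟨fun _ => w m, continuous_const, by simp, fun t _ => affineAt_const (w m) t⟩
    obtain ⟨b, hbT, hb⟩ := T.exists_max_image id hne
    have hbm : m - b ≠ 0 := (sub_pos.2 (hm b hbT)).ne'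
    refine ⟨φ + ((w m - φ m) / (m - b)) • fun s => max 0 (s - b), by fun_prop,
      (Finset.forall_mem_insert m T _).2 ⟨?_, fun t ht => ?_⟩, fun t ht => ?_⟩
    · simp [(hm b hbT).le, hbm]
    · simp [hφ t ht, show t ≤ b from hb t ht]
    · rw [Finset.mem_insert, not_or] at ht
      refine (haff t ht.2).add (AffineAt.const_smul _ ?_)
      rcases (ne_of_mem_of_not_mem hbT ht.2).lt_or_gt with hbt | htb
      · refine ⟨-b, 1, ?_⟩
        filter_upwards [Ioi_mem_nhds hbt] with s hs
        rw [max_eq_right (sub_nonneg.2 (Set.mem_Ioi.1 hs).le)]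
        ring
      · refine ⟨0, 0, ?_⟩
        filter_upwards [Iio_mem_nhds htb] with s hs
        rw [max_eq_left (sub_nonpos.2 (Set.mem_Iio.1 hs).le)]
        ring

lemma intervalIntegral_congr_off_finset {E : Type*} [NormedAddCommGroup E] [NormedSpace ℝ E]
    (T : Finset ℝ) (hab : a ≤ b) {F G : ℝ → E} (h : ∀ t ∈ Set.Ioo a b, t ∉ T → F t = G t) :
    ∫ t in a..b, F t = ∫ t in a..b, G t := by
  refine intervalIntegral.integral_congr_ae ?_
  filter_upwards [T.countable_toSet.ae_notMem volume, (Set.countable_singleton b).ae_notMem volume]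
    with t htT htb ht
  rw [Set.uIoc_of_le hab] at ht
  exact h t ⟨ht.1, lt_of_le_of_ne ht.2 htb⟩ htT

lemma continuousOn_Icc_of_forall_gap (T : Finset ℝ) (hab : a < b)
    (h : ∀ c d, a ≤ c → c < d → d ≤ b → (∀ t ∈ T, t ∉ Set.Ioo c d) →
      ∃ P : ℝ[X], Set.EqOn φ (fun s => P.eval s) (Set.Icc c d)) :
    ContinuousOn φ (Set.Icc a b) := by
  refine interval_induction (Q := fun c d => ContinuousOn φ (Set.Icc c d)) T hab
    (fun c d hc hcd hd hT => ?_) fun c m d _ hcm hmd _ _ hleft hright => ?_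
  · obtain ⟨P, hP⟩ := h c d hc hcd hd hT
    exact P.continuousOn.congr hP
  · rw [← Set.Icc_union_Icc_eq_Icc hcm.le hmd.le]
    exact hleft.union_of_isClosed hright isClosed_Icc isClosed_Icc

lemma polyAt_of_forall_gap (T : Finset ℝ) (hab : a < b)
    (h : ∀ c d, a ≤ c → c < d → d ≤ b → (∀ t ∈ T, t ∉ Set.Ioo c d) →
      ∃ P : ℝ[X], Set.EqOn φ (fun s => P.eval s) (Set.Icc c d)) :
    ∀ t ∈ Set.Ioo a b, t ∉ T → PolyAt φ t := by
  refine interval_induction (Q := fun c d => ∀ t ∈ Set.Ioo c d, t ∉ T → PolyAt φ t) T hab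
    (fun c d hc hcd hd hT t ht _ => ?_) fun c m d _ _ _ _ hm hleft hright t ht htT => ?_
  · obtain ⟨P, hP⟩ := h c d hc hcd hd hT
    exact polyAt_of_eqOn_polynomial hP ht
  · rcases (ne_of_mem_of_not_mem hm htT).lt_or_gt with hmt | htm
    · exact hright t ⟨hmt, ht.2⟩ htT
    · exact hleft t ⟨ht.1, htm⟩ htT

namespace PiecewisePoly

variable {T : Finset ℝ}

lemma mono (hφ : PiecewisePoly T a b φ) {c d : ℝ} (hc : a ≤ c) (hd : d ≤ b) :
    PiecewisePoly T c d φ :=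
  ⟨hφ.continuous, fun t ht => hφ.polyAt t ⟨hc.trans_lt ht.1, ht.2.trans_le hd⟩⟩

lemma exists_eqOn_polynomial (hφ : PiecewisePoly T a b φ) (hab : a < b)
    (hT : ∀ t ∈ T, t ∉ Set.Ioo a b) :
    ∃ P : ℝ[X], Set.EqOn φ (fun s => P.eval s) (Set.Icc a b) :=
  exists_eqOn_polynomial_of_forall_polyAt hab hφ.continuous.continuousOn fun t ht =>
    hφ.polyAt t ht fun htT => hT t htT ht

lemma intervalIntegrable_deriv_mul_deriv (hab : a < b) (hφ : PiecewisePoly T a b φ)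
    (hψ : PiecewisePoly T a b ψ) :
    IntervalIntegrable (fun t => deriv φ t * deriv ψ t) volume a b := by
  refine interval_induction T hab (fun c d hc hcd hd hT => ?_)
    fun _ _ _ _ _ _ _ _ => IntervalIntegrable.trans
  obtain ⟨P, hP⟩ := (hφ.mono hc hd).exists_eqOn_polynomial hcd hT
  obtain ⟨Q, hQ⟩ := (hψ.mono hc hd).exists_eqOn_polynomial hcd hT
  refine ((P.derivative * Q.derivative).continuous.intervalIntegrable c d).congr_uIoo ?_
  rw [Set.uIoo_of_le hcd.le]
  intro t ht
  simp only [eval_mul, deriv_eqOn_of_eqOn_polynomial hP ht, deriv_eqOn_of_eqOn_polynomial hQ ht]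

lemma intervalIntegrable_deriv_deriv (hab : a < b) (hφ : PiecewisePoly T a b φ) :
    IntervalIntegrable (deriv (deriv φ)) volume a b := by
  refine interval_induction T hab (fun c d hc hcd hd hT => ?_)
    fun _ _ _ _ _ _ _ _ => IntervalIntegrable.trans
  obtain ⟨P, hP⟩ := (hφ.mono hc hd).exists_eqOn_polynomial hcd hT
  refine (P.derivative.derivative.continuous.intervalIntegrable c d).congr_uIoo ?_
  rw [Set.uIoo_of_le hcd.le]
  exact (deriv_deriv_eqOn_of_eqOn_polynomial hP).symm

end PiecewisePoly

lemma integral_deriv_mul_deriv_of_eqOn_polynomial {P Q : ℝ[X]} (hab : a < b)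
    (hP : Set.EqOn φ (fun s => P.eval s) (Set.Icc a b))
    (hQ : Set.EqOn ψ (fun s => Q.eval s) (Set.Icc a b)) :
    (∫ t in a..b, deriv φ t * deriv ψ t) + ∫ t in a..b, deriv (deriv φ) t * ψ t =
      derivWithin φ (Set.Iic b) b * ψ b - derivWithin φ (Set.Ici a) a * ψ a := by
  have hfirst : ∫ t in a..b, deriv φ t * deriv ψ t =
      ∫ t in a..b, P.derivative.eval t * Q.derivative.eval t :=
    intervalIntegral.integral_congr_Ioo_of_le hab.le fun t ht => by
      simp only [deriv_eqOn_of_eqOn_polynomial hP ht, deriv_eqOn_of_eqOn_polynomial hQ ht]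
  have hsecond : ∫ t in a..b, deriv (deriv φ) t * ψ t =
      ∫ t in a..b, P.derivative.derivative.eval t * Q.eval t :=
    intervalIntegral.integral_congr_Ioo_of_le hab.le fun t ht => by
      simp only [deriv_deriv_eqOn_of_eqOn_polynomial hP ht, hQ (Set.Ioo_subset_Icc_self ht)]
  rw [hfirst, hsecond, derivWithin_Iic_of_eqOn_polynomial hab hP,
    derivWithin_Ici_of_eqOn_polynomial hab hP, hQ (Set.left_mem_Icc.2 hab.le),
    hQ (Set.right_mem_Icc.2 hab.le), intervalIntegral.integral_mul_deriv_eq_deriv_mul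
      (fun t _ => P.derivative.hasDerivAt t) (fun t _ => Q.hasDerivAt t)
      (P.derivative.derivative.continuous.intervalIntegrable a b)
      (Q.derivative.continuous.intervalIntegrable a b)]
  ring

namespace PiecewisePoly

variable {T : Finset ℝ}

lemma integral_deriv_mul_deriv (hab : a < b) (ha : a ∈ T) (hb : b ∈ T)
    (hφ : PiecewisePoly T a b φ) (hψ : PiecewisePoly T a b ψ) :
    (∫ t in a..b, deriv φ t * deriv ψ t) + ∫ t in a..b, deriv (deriv φ) t * ψ t =
      (∑ t ∈ T with t ∈ Set.Ioc a b, derivWithin φ (Set.Iic t) t * ψ t)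
        - ∑ t ∈ T with t ∈ Set.Ico a b, derivWithin φ (Set.Ici t) t * ψ t := by
  refine interval_induction (Q := fun c d => c ∈ T → d ∈ T →
      (∫ t in c..d, deriv φ t * deriv ψ t) + ∫ t in c..d, deriv (deriv φ) t * ψ t =
      (∑ t ∈ T with t ∈ Set.Ioc c d, derivWithin φ (Set.Iic t) t * ψ t)
        - ∑ t ∈ T with t ∈ Set.Ico c d, derivWithin φ (Set.Ici t) t * ψ t) T hab
    (fun c d hc hcd hd hT hcT hdT => ?_)
    (fun c m d hc hcm hmd hd hmT hleft hright hcT hdT => ?_) ha hb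
  · have filter_Ioc : T.filter (· ∈ Set.Ioc c d) = {d} := by grind
    have filter_Ico : T.filter (· ∈ Set.Ico c d) = {c} := by grind
    obtain ⟨P, hP⟩ := (hφ.mono hc hd).exists_eqOn_polynomial hcd hT
    obtain ⟨Q, hQ⟩ := (hψ.mono hc hd).exists_eqOn_polynomial hcd hT
    rw [filter_Ioc, filter_Ico, Finset.sum_singleton, Finset.sum_singleton,
      integral_deriv_mul_deriv_of_eqOn_polynomial hcd hP hQ]
  · have hcm' := And.intro (hφ.mono hc (hmd.le.trans hd)) (hψ.mono hc (hmd.le.trans hd))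
    have hmd' := And.intro (hφ.mono (hc.trans hcm.le) hd) (hψ.mono (hc.trans hcm.le) hd)
    simp only [← Set.Ioc_union_Ioc_eq_Ioc hcm.le hmd.le, ← Set.Ico_union_Ico_eq_Ico hcm.le hmd.le]
    rw [sum_filter_mem_union T (Set.Ioc_disjoint_Ioc_of_le le_rfl),
      sum_filter_mem_union T (Set.Ico_disjoint_Ico_same),
      ← intervalIntegral.integral_add_adjacent_intervals
        (intervalIntegrable_deriv_mul_deriv hcm hcm'.1 hcm'.2)
        (intervalIntegrable_deriv_mul_deriv hmd hmd'.1 hmd'.2),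
      ← intervalIntegral.integral_add_adjacent_intervals
        ((intervalIntegrable_deriv_deriv hcm hcm'.1).mul_continuousOn hψ.continuous.continuousOn)
        ((intervalIntegrable_deriv_deriv hmd hmd'.1).mul_continuousOn hψ.continuous.continuousOn)]
    linarith [hleft hcT hmT, hright hmT hdT]

lemma eq_of_integral_deriv_mul_self_eq_zero (hab : a < b) (hφ : PiecewisePoly T a b φ)
    (h : ∫ t in a..b, deriv φ t * deriv φ t = 0) : ∀ s ∈ Set.Icc a b, φ s = φ a := by
  have deriv_ae_eq_zero : ∀ᵐ t, t ∈ Set.Ioc a b → deriv φ t = 0 := by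
    rw [← ae_restrict_iff' measurableSet_Ioc]
    filter_upwards [(intervalIntegral.integral_eq_zero_iff_of_le_of_nonneg_ae hab.le
      (Eventually.of_forall fun t => mul_self_nonneg (deriv φ t))
      (intervalIntegrable_deriv_mul_deriv hab hφ hφ)).1 h] with t ht
    exact mul_self_eq_zero.1 ht
  intro s hs
  have deriv_ae_eq_zero' : ∀ᵐ t, t ∈ Set.uIoc a s → deriv φ t = 0 := by
    rw [Set.uIoc_of_le hs.1]
    filter_upwards [deriv_ae_eq_zero] with t h ht using h (Set.Ioc_subset_Ioc_right hs.2 ht)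
  have hint : IntervalIntegrable (deriv φ) volume a s :=
    (intervalIntegrable_const (c := (0 : ℝ))).congr_ae <|
      (ae_restrict_iff' measurableSet_uIoc).2 <| by
        filter_upwards [deriv_ae_eq_zero'] with t h ht using (h ht).symm
  have hFTC := integral_eq_of_hasDerivAt_off_countable_of_le φ (deriv φ) hs.1
    T.countable_toSet hφ.continuous.continuousOn
    (fun t ht => (hφ.polyAt t ⟨ht.1.1, ht.1.2.trans_le hs.2⟩ ht.2).differentiableAt.hasDerivAt) hint
  rw [intervalIntegral.integral_congr_ae (g := fun _ => 0) deriv_ae_eq_zero',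
    intervalIntegral.integral_zero] at hFTC
  exact sub_eq_zero.1 hFTC.symm

end PiecewisePoly

end RealLine

namespace MetrizedGraph

variable {Γ : MetrizedGraph.{u}}

section Points

lemma path_of_mem {e : Γ.Edge} {t : ℝ} (ht : t ∈ Set.Icc 0 (Γ.len e)) :
    Γ.path e t = Γ.proj ⟨e, ⟨t, ht⟩⟩ := by
  rw [path, Set.projIcc_of_mem]

lemma continuous_path (e : Γ.Edge) : Continuous (Γ.path e) :=
  Γ.continuous_proj.comp (continuous_sigmaMk.comp continuous_projIcc)

lemma exists_path_eq (x : Γ.Point) : ∃ e, ∃ t ∈ Set.Icc 0 (Γ.len e), Γ.path e t = x := by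
  obtain ⟨⟨e, t⟩, rfl⟩ := Γ.proj_surjective x
  exact ⟨e, t, t.2, path_of_mem t.2⟩

lemma continuous_of_forall_path {Y : Type*} [TopologicalSpace Y] {f : Γ.Point → Y}
    (h : ∀ e, ContinuousOn (fun t => f (Γ.path e t)) (Set.Icc 0 (Γ.len e))) : Continuous f := by
  refine continuous_coinduced_dom.2 (continuous_sigma fun e => ?_)
  refine (continuousOn_iff_continuous_domRestrict.1 (h e)).congr fun t => ?_
  rw [Set.domRestrict_apply, path_of_mem t.2, Function.comp_apply]

instance : CompactSpace Γ.Point :=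
  ⟨Γ.proj_surjective.range_eq ▸ isCompact_range Γ.continuous_proj⟩

variable (Γ) in
lemma finite_branch : (Set.range (fun e => Γ.path e 0) ∪ Set.range (fun e => Γ.path e (Γ.len e)) ∪
    Γ.proj '' {a | ∃ b, b ≠ a ∧ Γ.proj b = Γ.proj a}).Finite :=
  ((Set.finite_range _).union (Set.finite_range _)).union (Γ.finite_glued.image _)

/-- The points that are ends of segments or at which gluing takes place. -/
def branch (Γ : MetrizedGraph.{u}) : Finset Γ.Point := Γ.finite_branch.toFinset

lemma path_zero_mem_branch (e : Γ.Edge) : Γ.path e 0 ∈ Γ.branch := by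
  simp [branch]

lemma path_len_mem_branch (e : Γ.Edge) : Γ.path e (Γ.len e) ∈ Γ.branch := by
  simp [branch]

lemma eq_of_path_eq {e e' : Γ.Edge} {t t' : ℝ} (ht : t ∈ Set.Icc 0 (Γ.len e))
    (ht' : t' ∈ Set.Icc 0 (Γ.len e')) (h : Γ.path e' t' = Γ.path e t)
    (hb : Γ.path e t ∉ Γ.branch) : e' = e ∧ t' = t := by
  by_contra hne
  rw [branch, Set.Finite.mem_toFinset, path_of_mem ht] at hb
  refine hb (.inr ⟨_, ⟨⟨e', ⟨t', ht'⟩⟩, fun heq => hne ?_, ?_⟩, rfl⟩)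
  · cases heq
    exact ⟨rfl, rfl⟩
  · rw [← path_of_mem, ← path_of_mem, h]

lemma mem_Ioo_of_path_notMem_branch {e : Γ.Edge} {t : ℝ} (ht : t ∈ Set.Icc 0 (Γ.len e))
    (hb : Γ.path e t ∉ Γ.branch) : t ∈ Set.Ioo 0 (Γ.len e) :=
  ⟨ht.1.lt_of_ne (by rintro rfl; exact hb (path_zero_mem_branch e)),
    ht.2.lt_of_ne (by rintro rfl; exact hb (path_len_mem_branch e))⟩

lemma finite_setOf_path_mem (V : Finset Γ.Point) (e : Γ.Edge) :
    {t | t ∈ Set.Icc 0 (Γ.len e) ∧ Γ.path e t ∈ V}.Finite := by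
  have hfiber : (⋃ x ∈ V, {a | Γ.proj a = x}).Finite :=
    V.finite_toSet.biUnion fun x _ => Γ.finite_fiber x
  refine ((hfiber.preimage (sigma_mk_injective (i := e)).injOn).image Subtype.val).subset ?_
  rintro t ⟨ht, htV⟩
  exact ⟨⟨t, ht⟩, by simpa [path_of_mem ht] using htV, rfl⟩

/-- The parameters on the segment `e` of the points of `V`. -/
def breaks (V : Finset Γ.Point) (e : Γ.Edge) : Finset ℝ := (finite_setOf_path_mem V e).toFinset

lemma mem_breaks {V : Finset Γ.Point} {e : Γ.Edge} {t : ℝ} :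
    t ∈ breaks V e ↔ t ∈ Set.Icc 0 (Γ.len e) ∧ Γ.path e t ∈ V := by
  simp [breaks]

end Points

/-- The function `f` is continuous, and in the parameters of the segments it is locally polynomial
off the finite set `V`. -/
structure PolyOff (V : Finset Γ.Point) (f : Γ.Point → ℝ) : Prop where
  continuous : Continuous f
  polyAt : ∀ e, ∀ t ∈ Set.Ioo 0 (Γ.len e), Γ.path e t ∉ V → PolyAt (fun s => f (Γ.path e s)) t

/-- The function `f` is continuous, and in the parameters of the segments it is locally affine
off the finite set `V`. -/
structure AffineOff (V : Finset Γ.Point) (f : Γ.Point → ℝ) : Prop where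
  continuous : Continuous f
  affineAt : ∀ e, ∀ t ∈ Set.Ioo 0 (Γ.len e), Γ.path e t ∉ V →
    AffineAt (fun s => f (Γ.path e s)) t

section PiecewisePolynomial

variable {V W : Finset Γ.Point} {f g : Γ.Point → ℝ}

lemma affineOff_const (V : Finset Γ.Point) (c : ℝ) : AffineOff V (fun _ => c) :=
  ⟨continuous_const, fun _ t _ _ => affineAt_const c t⟩

lemma AffineOff.add (hf : AffineOff V f) (hg : AffineOff V g) : AffineOff V (f + g) :=
  ⟨hf.continuous.add hg.continuous,
    fun e t ht htV => (hf.affineAt e t ht htV).add (hg.affineAt e t ht htV)⟩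

lemma AffineOff.const_smul (c : ℝ) (hf : AffineOff V f) : AffineOff V (c • f) :=
  ⟨hf.continuous.const_smul c, fun e t ht htV => (hf.affineAt e t ht htV).const_smul c⟩

lemma AffineOff.polyOff (hf : AffineOff V f) : PolyOff V f :=
  ⟨hf.continuous, fun e t ht htV => (hf.affineAt e t ht htV).polyAt⟩

lemma PolyOff.mono (hf : PolyOff V f) (hVW : V ⊆ W) : PolyOff W f :=
  ⟨hf.continuous, fun e t ht htW => hf.polyAt e t ht fun htV => htW (hVW htV)⟩

lemma PolyOff.piecewisePoly_path (hf : PolyOff V f) (e : Γ.Edge) :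
    PiecewisePoly (breaks V e) 0 (Γ.len e) (fun s => f (Γ.path e s)) :=
  ⟨hf.continuous.comp (continuous_path e), fun t ht htV => hf.polyAt e t ht fun h =>
    htV (mem_breaks.2 ⟨Set.Ioo_subset_Icc_self ht, h⟩)⟩

open Classical in
lemma exists_polyOff_polyOff (hf : ∃ V, PolyOff V f) (hg : ∃ V, PolyOff V g) :
    ∃ V, PolyOff V f ∧ PolyOff V g := by
  obtain ⟨V, hV⟩ := hf
  obtain ⟨W, hW⟩ := hg
  exact ⟨V ∪ W, hV.mono Finset.subset_union_left, hW.mono Finset.subset_union_right⟩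

variable (Γ) in
/-- The algebra of continuous functions that are polynomial in the parameters of the segments off a
finite set of points. -/
def piecewisePoly : Subalgebra ℝ (Γ.Point → ℝ) where
  carrier := {f | ∃ V, PolyOff V f}
  add_mem' hf hg := by
    obtain ⟨V, hf, hg⟩ := exists_polyOff_polyOff hf hg
    exact ⟨V, hf.continuous.add hg.continuous,
      fun e t ht htV => (hf.polyAt e t ht htV).add (hg.polyAt e t ht htV)⟩
  mul_mem' hf hg := by
    obtain ⟨V, hf, hg⟩ := exists_polyOff_polyOff hf hg
    exact ⟨V, hf.continuous.mul hg.continuous,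
      fun e t ht htV => (hf.polyAt e t ht htV).mul (hg.polyAt e t ht htV)⟩
  algebraMap_mem' c := ⟨∅, (affineOff_const ∅ c).polyOff⟩

lemma PolyOff.mem_piecewisePoly (hf : PolyOff V f) : f ∈ Γ.piecewisePoly := ⟨V, hf⟩

lemma continuous_of_mem_piecewisePoly (hf : f ∈ Γ.piecewisePoly) : Continuous f :=
  hf.choose_spec.continuous

lemma exists_finset_forall_differentiableAt (hf : f ∈ Γ.piecewisePoly) (e : Γ.Edge) :
    ∃ T : Finset ℝ, ∀ t ∈ Set.Ioo 0 (Γ.len e), t ∉ T →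
      DifferentiableAt ℝ (fun s => f (Γ.path e s)) t := by
  obtain ⟨V, hV⟩ := hf
  exact ⟨breaks V e, fun t ht htV =>
    ((hV.piecewisePoly_path e).polyAt t ht htV).differentiableAt⟩

end PiecewisePolynomial

/-- The weighted Dirichlet pairing `∫ h f' g' dx`. -/
def energy (h f g : Γ.Point → ℝ) : ℝ :=
  ∑ e, ∫ t in (0 : ℝ)..Γ.len e,
    h (Γ.path e t) * (deriv (fun s => f (Γ.path e s)) t * deriv (fun s => g (Γ.path e s)) t)

section Energy

variable {h h' f f' g : Γ.Point → ℝ}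

lemma energy_comm (h f g : Γ.Point → ℝ) : energy h f g = energy h g f := by
  simp only [energy, mul_comm (deriv (fun s => f (Γ.path _ s)) _)]

lemma intervalIntegrable_energy (hh : Continuous h) (hf : f ∈ Γ.piecewisePoly)
    (hg : g ∈ Γ.piecewisePoly) (e : Γ.Edge) :
    IntervalIntegrable (fun t => h (Γ.path e t) *
      (deriv (fun s => f (Γ.path e s)) t * deriv (fun s => g (Γ.path e s)) t))
      volume 0 (Γ.len e) := by
  obtain ⟨V, hfV, hgV⟩ := exists_polyOff_polyOff hf hg
  exact (PiecewisePoly.intervalIntegrable_deriv_mul_deriv (Γ.len_pos e) (hfV.piecewisePoly_path e)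
    (hgV.piecewisePoly_path e)).continuousOn_mul (hh.comp (continuous_path e)).continuousOn

lemma energy_add_weight (hh : Continuous h) (hh' : Continuous h') (hf : f ∈ Γ.piecewisePoly)
    (hg : g ∈ Γ.piecewisePoly) : energy (h + h') f g = energy h f g + energy h' f g := by
  simp only [energy, ← Finset.sum_add_distrib, Pi.add_apply, add_mul]
  exact Finset.sum_congr rfl fun e _ => intervalIntegral.integral_add
    (intervalIntegrable_energy hh hf hg e) (intervalIntegrable_energy hh' hf hg e)

lemma energy_smul_weight (c : ℝ) (h f g : Γ.Point → ℝ) :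
    energy (c • h) f g = c * energy h f g := by
  simp only [energy, Pi.smul_apply, smul_eq_mul, mul_assoc, intervalIntegral.integral_const_mul,
    Finset.mul_sum]

lemma energy_add_left (hh : Continuous h) (hf : f ∈ Γ.piecewisePoly) (hf' : f' ∈ Γ.piecewisePoly)
    (hg : g ∈ Γ.piecewisePoly) : energy h (f + f') g = energy h f g + energy h f' g := by
  simp only [energy, ← Finset.sum_add_distrib]
  refine Finset.sum_congr rfl fun e _ => ?_
  obtain ⟨T, hT⟩ := exists_finset_forall_differentiableAt hf e
  obtain ⟨T', hT'⟩ := exists_finset_forall_differentiableAt hf' e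
  rw [← intervalIntegral.integral_add (intervalIntegrable_energy hh hf hg e)
    (intervalIntegrable_energy hh hf' hg e)]
  refine intervalIntegral_congr_off_finset (T ∪ T') (Γ.len_pos e).le fun t ht htT => ?_
  rw [Finset.notMem_union] at htT
  simp only [Pi.add_apply, deriv_fun_add (hT t ht htT.1) (hT' t ht htT.2)]
  ring

lemma energy_smul_left (c : ℝ) (h f g : Γ.Point → ℝ) :
    energy h (c • f) g = c * energy h f g := by
  simp only [energy, Pi.smul_apply, smul_eq_mul, deriv_const_mul_field, Finset.mul_sum,
    ← intervalIntegral.integral_const_mul]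
  exact Finset.sum_congr rfl fun e _ => intervalIntegral.integral_congr fun _ _ => by ring

lemma energy_sub_left (hh : Continuous h) (hf : f ∈ Γ.piecewisePoly) (hf' : f' ∈ Γ.piecewisePoly)
    (hg : g ∈ Γ.piecewisePoly) : energy h (f - f') g = energy h f g - energy h f' g := by
  rw [sub_eq_add_neg, ← neg_one_smul ℝ f',
    energy_add_left hh hf (Γ.piecewisePoly.smul_mem hf' _) hg, energy_smul_left]
  ring

lemma energy_const_left (h : Γ.Point → ℝ) (c : ℝ) (g : Γ.Point → ℝ) :
    energy h (fun _ => c) g = 0 := by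
  simp [energy]

lemma energy_mul_left (hh : Continuous h) (hf : f ∈ Γ.piecewisePoly) (hf' : f' ∈ Γ.piecewisePoly)
    (hg : g ∈ Γ.piecewisePoly) :
    energy h (f * f') g = energy (h * f') f g + energy (h * f) f' g := by
  simp only [energy, ← Finset.sum_add_distrib]
  refine Finset.sum_congr rfl fun e _ => ?_
  obtain ⟨T, hT⟩ := exists_finset_forall_differentiableAt hf e
  obtain ⟨T', hT'⟩ := exists_finset_forall_differentiableAt hf' e
  rw [← intervalIntegral.integral_add
    (intervalIntegrable_energy (hh.mul (continuous_of_mem_piecewisePoly hf')) hf hg e)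
    (intervalIntegrable_energy (hh.mul (continuous_of_mem_piecewisePoly hf)) hf' hg e)]
  refine intervalIntegral_congr_off_finset (T ∪ T') (Γ.len_pos e).le fun t ht htT => ?_
  rw [Finset.notMem_union] at htT
  simp only [Pi.mul_apply, deriv_fun_mul (hT t ht htT.1) (hT' t ht htT.2)]
  ring

lemma energy_integrand_self_nonneg (f : Γ.Point → ℝ) (e : Γ.Edge) :
    0 ≤ ∫ t in (0 : ℝ)..Γ.len e, (1 : Γ.Point → ℝ) (Γ.path e t) *
      (deriv (fun s => f (Γ.path e s)) t * deriv (fun s => f (Γ.path e s)) t) :=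
  intervalIntegral.integral_nonneg (Γ.len_pos e).le fun _ _ =>
    mul_nonneg zero_le_one (mul_self_nonneg _)

lemma energy_self_nonneg (f : Γ.Point → ℝ) : 0 ≤ energy 1 f f :=
  Finset.sum_nonneg fun e _ => energy_integrand_self_nonneg f e

lemma eq_of_energy_self_eq_zero (hf : f ∈ Γ.piecewisePoly) (h0 : energy 1 f f = 0)
    (x y : Γ.Point) : f x = f y := by
  obtain ⟨V, hV⟩ := hf
  have integral_eq_zero := (Finset.sum_eq_zero_iff_of_nonneg
    fun e _ => energy_integrand_self_nonneg f e).1 h0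
  have eq_on_segment : ∀ e, ∀ t ∈ Set.Icc 0 (Γ.len e), f (Γ.path e t) = f (Γ.path e 0) :=
    fun e => (hV.piecewisePoly_path e).eq_of_integral_deriv_mul_self_eq_zero (Γ.len_pos e)
      (by simpa using integral_eq_zero e (Finset.mem_univ e))
  have finite_range : (Set.range f).Finite := by
    refine (Set.finite_range fun e => f (Γ.path e 0)).subset ?_
    rintro _ ⟨x, rfl⟩
    obtain ⟨e, t, ht, rfl⟩ := exists_path_eq x
    exact ⟨e, (eq_on_segment e t ht).symm⟩
  by_contra hne
  exact (isPreconnected_range hV.continuous).infinite_of_nontrivial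
    ⟨f x, ⟨x, rfl⟩, f y, ⟨y, rfl⟩, hne⟩ finite_range

end Energy

section Green

variable {V : Finset Γ.Point} {f g : Γ.Point → ℝ}

open Classical in
lemma sum_finsum_path_eq_mul (V : Finset Γ.Point) {e : Γ.Edge} {I : Set ℝ}
    (hI : I ⊆ Set.Icc 0 (Γ.len e)) (F : ℝ → ℝ) (g : Γ.Point → ℝ) :
    ∑ x ∈ V, (∑ᶠ t ∈ {t | t ∈ I ∧ Γ.path e t = x}, F t) * g x =
      ∑ t ∈ breaks V e with t ∈ I, F t * g (Γ.path e t) := by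
  have maps_to : ∀ t ∈ (breaks V e).filter (· ∈ I), Γ.path e t ∈ V := fun t ht =>
    (mem_breaks.1 (Finset.mem_filter.1 ht).1).2
  rw [← Finset.sum_fiberwise_of_maps_to maps_to]
  refine Finset.sum_congr rfl fun x hx => ?_
  have fiber_eq : {t | t ∈ I ∧ Γ.path e t = x} =
      ↑(((breaks V e).filter (· ∈ I)).filter (Γ.path e · = x)) := by
    ext t
    simp only [Finset.coe_filter, Set.mem_ofPred_eq, Finset.mem_filter, mem_breaks]
    exact ⟨fun h => ⟨⟨⟨hI h.1, h.2 ▸ hx⟩, h.1⟩, h.2⟩, fun h => ⟨h.1.2, h.2⟩⟩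
  rw [fiber_eq, finsum_mem_coe_finset, Finset.sum_mul]
  exact Finset.sum_congr rfl fun t ht => by rw [(Finset.mem_filter.1 ht).2]

lemma sum_slopeSum_mul (V : Finset Γ.Point) (f g : Γ.Point → ℝ) :
    ∑ x ∈ V, Γ.slopeSum f x * g x = ∑ e,
      ((∑ t ∈ breaks V e with t ∈ Set.Ico 0 (Γ.len e),
          derivWithin (fun s => f (Γ.path e s)) (Set.Ici t) t * g (Γ.path e t))
        - ∑ t ∈ breaks V e with t ∈ Set.Ioc 0 (Γ.len e),
          derivWithin (fun s => f (Γ.path e s)) (Set.Iic t) t * g (Γ.path e t)) := by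
  simp only [slopeSum, Finset.sum_mul, add_mul]
  rw [Finset.sum_comm]
  refine Finset.sum_congr rfl fun e _ => ?_
  rw [Finset.sum_add_distrib, sum_finsum_path_eq_mul V Set.Ico_subset_Icc_self,
    sum_finsum_path_eq_mul V Set.Ioc_subset_Icc_self, sub_eq_add_neg, ← Finset.sum_neg_distrib]
  simp only [neg_mul]
  congr!

lemma energy_add_integral_deriv_deriv_mul (hV : Γ.branch ⊆ V) (hf : PolyOff V f)
    (hg : PolyOff V g) :
    energy 1 f g + ∑ e, ∫ t in (0 : ℝ)..Γ.len e,
        deriv (deriv fun s => f (Γ.path e s)) t * g (Γ.path e t) =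
      -∑ x ∈ V, Γ.slopeSum f x * g x := by
  rw [sum_slopeSum_mul, energy, ← Finset.sum_add_distrib, ← Finset.sum_neg_distrib]
  refine Finset.sum_congr rfl fun e _ => ?_
  simp only [Pi.one_apply, one_mul]
  rw [neg_sub]
  exact PiecewisePoly.integral_deriv_mul_deriv (Γ.len_pos e)
    (mem_breaks.2 ⟨Set.left_mem_Icc.2 (Γ.len_pos e).le, hV (path_zero_mem_branch e)⟩)
    (mem_breaks.2 ⟨Set.right_mem_Icc.2 (Γ.len_pos e).le, hV (path_len_mem_branch e)⟩)
    (hf.piecewisePoly_path e) (hg.piecewisePoly_path e)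

lemma AffineOff.energy_eq (hV : Γ.branch ⊆ V) (hf : AffineOff V f) (hg : PolyOff V g) :
    energy 1 f g = -∑ x ∈ V, Γ.slopeSum f x * g x := by
  rw [← energy_add_integral_deriv_deriv_mul hV hf.polyOff hg, left_eq_add]
  refine Finset.sum_eq_zero fun e _ => ?_
  rw [intervalIntegral_congr_off_finset (G := fun _ => 0) (breaks V e) (Γ.len_pos e).le,
    intervalIntegral.integral_zero]
  intro t ht htV
  rw [AffineAt.deriv_deriv, zero_mul]
  exact hf.affineAt e t ht fun h => htV (mem_breaks.2 ⟨Set.Ioo_subset_Icc_self ht, h⟩)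

lemma setOf_mem_and_path_eq_path {e : Γ.Edge} {I : Set ℝ} (hI : I ⊆ Set.Icc 0 (Γ.len e)) {t : ℝ}
    (ht : t ∈ I) (hb : Γ.path e t ∉ Γ.branch) :
    {s | s ∈ I ∧ Γ.path e s = Γ.path e t} = {t} := by
  refine Set.Subset.antisymm (fun s hs => (eq_of_path_eq (hI ht) (hI hs.1) hs.2 hb).2) ?_
  rintro _ rfl
  exact ⟨ht, rfl⟩

lemma setOf_mem_and_path_eq_path_of_ne {e e' : Γ.Edge} (hne : e' ≠ e) {I : Set ℝ}
    (hI : I ⊆ Set.Icc 0 (Γ.len e')) {t : ℝ} (ht : t ∈ Set.Icc 0 (Γ.len e))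
    (hb : Γ.path e t ∉ Γ.branch) : {s | s ∈ I ∧ Γ.path e' s = Γ.path e t} = ∅ :=
  Set.eq_empty_of_forall_notMem fun _ hs => hne (eq_of_path_eq ht (hI hs.1) hs.2 hb).1

lemma slopeSum_path {e : Γ.Edge} {t : ℝ} (ht : t ∈ Set.Icc 0 (Γ.len e))
    (hb : Γ.path e t ∉ Γ.branch) (f : Γ.Point → ℝ) :
    Γ.slopeSum f (Γ.path e t) = derivWithin (fun s => f (Γ.path e s)) (Set.Ici t) t -
      derivWithin (fun s => f (Γ.path e s)) (Set.Iic t) t := by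
  have ht' := mem_Ioo_of_path_notMem_branch ht hb
  rw [slopeSum, Finset.sum_eq_single_of_mem e (Finset.mem_univ e)]
  · rw [setOf_mem_and_path_eq_path Set.Ico_subset_Icc_self (Set.Ioo_subset_Ico_self ht') hb,
      setOf_mem_and_path_eq_path Set.Ioc_subset_Icc_self (Set.Ioo_subset_Ioc_self ht') hb,
      finsum_mem_singleton, finsum_mem_singleton, sub_eq_add_neg]
  · intro e' _ hne
    rw [setOf_mem_and_path_eq_path_of_ne hne Set.Ico_subset_Icc_self ht hb,
      setOf_mem_and_path_eq_path_of_ne hne Set.Ioc_subset_Icc_self ht hb,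
      finsum_mem_empty, finsum_mem_empty, add_zero]

lemma PolyOff.slopeSum_eq_zero (hV : Γ.branch ⊆ V) (hf : PolyOff V f) {x : Γ.Point}
    (hx : x ∉ V) : Γ.slopeSum f x = 0 := by
  obtain ⟨e, t, ht, rfl⟩ := exists_path_eq x
  have hb : Γ.path e t ∉ Γ.branch := fun h => hx (hV h)
  have hdiff := (hf.polyAt e t (mem_Ioo_of_path_notMem_branch ht hb) hx).differentiableAt
  rw [slopeSum_path ht hb, hdiff.derivWithin (uniqueDiffWithinAt_Ici t),
    hdiff.derivWithin (uniqueDiffWithinAt_Iic t), sub_self]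

end Green

section Existence

variable {V : Finset Γ.Point} {f g : Γ.Point → ℝ} {y z : Γ.Point}

lemma exists_affineOff_eq (hV : Γ.branch ⊆ V) (w : Γ.Point → ℝ) :
    ∃ f, AffineOff V f ∧ ∀ x ∈ V, f x = w x := by
  choose φ φ_continuous φ_eq φ_affineAt using fun e =>
    exists_piecewiseAffine_interpolation (breaks V e) fun t => w (Γ.path e t)
  choose E τ hτ path_τ using exists_path_eq (Γ := Γ)
  let f (x : Γ.Point) : ℝ := φ (E x) (τ x)
  have f_eq_w : ∀ x ∈ V, f x = w x := fun x hx => by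
    simpa only [path_τ] using φ_eq (E x) (τ x) (mem_breaks.2 ⟨hτ x, by rwa [path_τ x]⟩)
  have f_path : ∀ e, ∀ t ∈ Set.Icc 0 (Γ.len e), f (Γ.path e t) = φ e t := by
    intro e t ht
    by_cases hx : Γ.path e t ∈ V
    · rw [f_eq_w _ hx, φ_eq e t (mem_breaks.2 ⟨ht, hx⟩)]
    · obtain ⟨hE, hτ⟩ := eq_of_path_eq ht (hτ (Γ.path e t)) (path_τ _) fun h => hx (hV h)
      simp only [f, hE, hτ]
  refine ⟨f, ⟨continuous_of_forall_path fun e => ?_, fun e t ht htV => ?_⟩, f_eq_w⟩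
  · exact (φ_continuous e).continuousOn.congr (f_path e)
  · obtain ⟨a, b, hab⟩ := φ_affineAt e t fun h => htV (mem_breaks.1 h).2
    refine ⟨a, b, ?_⟩
    filter_upwards [hab, Icc_mem_nhds ht.1 ht.2] with s hs hs_mem
    rw [f_path e s hs_mem, hs]

/-- The space of continuous functions that are affine off `V` and vanish at `z`. The Dirichlet form
`energy 1` is positive definite on it. -/
def groundedAffine (V : Finset Γ.Point) (z : Γ.Point) : Submodule ℝ (Γ.Point → ℝ) where
  carrier := {f | AffineOff V f ∧ f z = 0}
  add_mem' hf hg := ⟨hf.1.add hg.1, by simp [hf.2, hg.2]⟩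
  zero_mem' := ⟨affineOff_const V 0, rfl⟩
  smul_mem' c _ hf := ⟨hf.1.const_smul c, by simp [hf.2]⟩

lemma mem_piecewisePoly_of_mem_groundedAffine (hf : f ∈ groundedAffine V z) :
    f ∈ Γ.piecewisePoly := hf.1.polyOff.mem_piecewisePoly

lemma eq_zero_of_mem_groundedAffine (hf : f ∈ groundedAffine V z) (h : energy 1 f f = 0) :
    f = 0 := by
  ext x
  rw [eq_of_energy_self_eq_zero (mem_piecewisePoly_of_mem_groundedAffine hf) h x z, hf.2,
    Pi.zero_apply]

/-- A function in the space is determined by its values on `V`. -/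
lemma finiteDimensional_groundedAffine (hV : Γ.branch ⊆ V) (z : Γ.Point) :
    FiniteDimensional ℝ (groundedAffine V z) := by
  let restrict : groundedAffine V z →ₗ[ℝ] (V → ℝ) :=
    LinearMap.funLeft ℝ ℝ Subtype.val ∘ₗ (groundedAffine V z).subtype
  refine Module.Finite.of_injective restrict ((injective_iff_map_eq_zero _).2 fun f hf => ?_)
  refine Subtype.ext (eq_zero_of_mem_groundedAffine f.2 ?_)
  rw [f.2.1.energy_eq hV f.2.1.polyOff, Finset.sum_eq_zero, neg_zero]
  intro x hx
  rw [show f.1 x = 0 from congrFun hf ⟨x, hx⟩, mul_zero]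

/-- The Dirichlet form on `groundedAffine V z`. -/
def dirichletForm (V : Finset Γ.Point) (z : Γ.Point) : LinearMap.BilinForm ℝ (groundedAffine V z) :=
  LinearMap.mk₂ ℝ (fun f g => energy 1 f.1 g.1)
    (fun f f' g => energy_add_left continuous_one (mem_piecewisePoly_of_mem_groundedAffine f.2)
      (mem_piecewisePoly_of_mem_groundedAffine f'.2) (mem_piecewisePoly_of_mem_groundedAffine g.2))
    (fun c f g => energy_smul_left c 1 f.1 g.1)
    (fun f g g' => by
      simp only [energy_comm 1 f.1]
      exact energy_add_left continuous_one (mem_piecewisePoly_of_mem_groundedAffine g.2)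
        (mem_piecewisePoly_of_mem_groundedAffine g'.2)
        (mem_piecewisePoly_of_mem_groundedAffine f.2))
    (fun c f g => by
      simp only [energy_comm 1 f.1]
      exact energy_smul_left c 1 g.1 f.1)

lemma nondegenerate_dirichletForm (V : Finset Γ.Point) (z : Γ.Point) :
    (dirichletForm V z).Nondegenerate :=
  ⟨fun f hf => Subtype.ext (eq_zero_of_mem_groundedAffine f.2 (hf f)),
    fun f hf => Subtype.ext (eq_zero_of_mem_groundedAffine f.2 (hf f))⟩

lemma exists_forall_energy_eq (hV : Γ.branch ⊆ V) (z y : Γ.Point) :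
    ∃ f ∈ groundedAffine V z, ∀ g, AffineOff V g → energy 1 f g = g y - g z := by
  have := finiteDimensional_groundedAffine hV z
  let eval : Module.Dual ℝ (groundedAffine V z) :=
    LinearMap.proj y ∘ₗ (groundedAffine V z).subtype
  let f := ((dirichletForm V z).toDual (nondegenerate_dirichletForm V z)).symm eval
  refine ⟨f, f.2, fun g hg => ?_⟩
  have hgz : AffineOff V fun _ => -g z := affineOff_const V _
  have h : energy 1 f.1 (g + fun _ => -g z) = g y + -g z :=
    LinearMap.BilinForm.apply_toDual_symm_apply (hB := nondegenerate_dirichletForm V z) eval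
      ⟨g + fun _ => -g z, hg.add hgz, by simp⟩
  rwa [energy_comm, energy_add_left continuous_one hg.polyOff.mem_piecewisePoly
    hgz.polyOff.mem_piecewisePoly (mem_piecewisePoly_of_mem_groundedAffine f.2), energy_const_left,
    add_zero, energy_comm, ← sub_eq_add_neg] at h

open Classical in
/-- The slope sums are read off the energy by testing with the interpolations of delta functions. -/
lemma exists_isVoltage_affineOff (hV : Γ.branch ⊆ V) (hz : z ∈ V) (hy : y ∈ V) :
    ∃ f, Γ.IsVoltage z y f ∧ AffineOff V f := by
  obtain ⟨f, ⟨hf, ground⟩, energy_eq⟩ := exists_forall_energy_eq hV z y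
  refine ⟨f, ⟨hf.continuous, ⟨V, V.finite_toSet, hf.affineAt⟩, fun x => ?_, ground⟩, hf⟩
  by_cases hx : x ∈ V
  · obtain ⟨δ, hδ, δ_eq⟩ := exists_affineOff_eq hV fun w => if w = x then (1 : ℝ) else 0
    have slopeSum_eq : ∑ w ∈ V, Γ.slopeSum f w * δ w = Γ.slopeSum f x := by
      rw [Finset.sum_congr rfl fun w hw => by rw [δ_eq w hw, mul_ite, mul_one, mul_zero],
        Finset.sum_ite_eq' V x, if_pos hx]
    have := energy_eq δ hδ
    rw [hf.energy_eq hV hδ.polyOff, slopeSum_eq, δ_eq y hy, δ_eq z hz] at this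
    simp only [eq_comm (a := x)]
    linarith
  · rw [hf.polyOff.slopeSum_eq_zero hV hx, if_neg (by rintro rfl; exact hx hz),
      if_neg (by rintro rfl; exact hx hy), sub_zero]

end Existence

section Voltage

variable {f g : Γ.Point → ℝ} {w x y z : Γ.Point}

open Classical in
lemma IsVoltage.exists_affineOff (hf : Γ.IsVoltage z y f) (W : Finset Γ.Point) :
    ∃ V, W ⊆ V ∧ AffineOff V f := by
  obtain ⟨S, hS, affineAt⟩ := hf.locally_affine
  exact ⟨W ∪ hS.toFinset, Finset.subset_union_left, hf.continuous, fun e t ht htV =>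
    affineAt e t ht fun h => htV (Finset.mem_union_right _ (hS.mem_toFinset.2 h))⟩

lemma IsVoltage.mem_piecewisePoly (hf : Γ.IsVoltage z y f) : f ∈ Γ.piecewisePoly :=
  (hf.exists_affineOff ∅).choose_spec.2.polyOff.mem_piecewisePoly

open Classical in
lemma IsVoltage.energy_eq (hf : Γ.IsVoltage z y f) (hg : g ∈ Γ.piecewisePoly) :
    energy 1 f g = g y - g z := by
  obtain ⟨W, hW⟩ := hg
  obtain ⟨V, hWV, hfV⟩ := hf.exists_affineOff (Γ.branch ∪ W ∪ {z, y})
  have hz : z ∈ V := hWV (by simp)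
  have hy : y ∈ V := hWV (by simp)
  rw [hfV.energy_eq (fun x hx => hWV (by simp [hx])) (hW.mono fun x hx => hWV (by simp [hx]))]
  simp only [hf.slopeSum_eq, sub_mul, ite_mul, one_mul, zero_mul, Finset.sum_sub_distrib,
    Finset.sum_ite_eq', if_pos hz, if_pos hy, neg_sub]

lemma isVoltage_voltage (z y : Γ.Point) : Γ.IsVoltage z y (fun x => Γ.voltage z x y) := by
  classical
  have h : ∃ f, Γ.IsVoltage z y f :=
    (exists_isVoltage_affineOff (V := Γ.branch ∪ {z, y}) Finset.subset_union_left
      (by simp) (by simp)).imp fun _ => And.left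
  simp only [voltage, dif_pos h]
  exact h.choose_spec

lemma voltage_mem_piecewisePoly (z y : Γ.Point) :
    (fun x => Γ.voltage z x y) ∈ Γ.piecewisePoly := (isVoltage_voltage z y).mem_piecewisePoly

lemma energy_voltage (z y : Γ.Point) (hg : g ∈ Γ.piecewisePoly) :
    energy 1 (fun x => Γ.voltage z x y) g = g y - g z := (isVoltage_voltage z y).energy_eq hg

lemma voltage_ground (z y : Γ.Point) : Γ.voltage z z y = 0 := (isVoltage_voltage z y).ground

lemma voltage_sub_voltage_eq_of_energy_eq (hf : f ∈ Γ.piecewisePoly)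
    (h : ∀ g ∈ Γ.piecewisePoly, energy 1 f g = g y - g z) (x w : Γ.Point) :
    Γ.voltage z x y - Γ.voltage z w y = f x - f w := by
  have hj := voltage_mem_piecewisePoly z y
  have hsub := sub_mem hj hf
  have : energy 1 ((fun x => Γ.voltage z x y) - f) ((fun x => Γ.voltage z x y) - f) = 0 := by
    rw [energy_sub_left continuous_one hj hf hsub, energy_voltage z y hsub, h _ hsub, sub_self]
  have := eq_of_energy_self_eq_zero hsub this x w
  simp only [Pi.sub_apply] at this
  linarith

lemma voltage_symm (z x y : Γ.Point) : Γ.voltage z x y = Γ.voltage z y x := by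
  have hx := energy_voltage z x (voltage_mem_piecewisePoly z y)
  have hy := energy_voltage z y (voltage_mem_piecewisePoly z x)
  simp only [voltage_ground, sub_zero] at hx hy
  rw [← hx, ← hy, energy_comm]

lemma affineOff_voltage [DecidableEq Γ.Point] (z y : Γ.Point) :
    AffineOff (Γ.branch ∪ {z, y}) (fun x => Γ.voltage z x y) := by
  obtain ⟨f, hf, hfa⟩ := exists_isVoltage_affineOff (V := Γ.branch ∪ {z, y}) (z := z) (y := y)
    Finset.subset_union_left (by simp) (by simp)
  convert hfa using 2 with x
  have := voltage_sub_voltage_eq_of_energy_eq hf.mem_piecewisePoly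
    (fun g hg => hf.energy_eq hg) x z
  rwa [voltage_ground, hf.ground, sub_zero, sub_zero] at this

lemma voltage_change_ground (z w x y : Γ.Point) :
    Γ.voltage w x y = Γ.voltage z x y - Γ.voltage z x w - Γ.voltage z w y + Γ.voltage z w w := by
  have hy := voltage_mem_piecewisePoly z y
  have hw := voltage_mem_piecewisePoly z w
  have := voltage_sub_voltage_eq_of_energy_eq (z := w) (y := y) (sub_mem hy hw)
    (fun g hg => by
      rw [energy_sub_left continuous_one hy hw hg, energy_voltage z y hg, energy_voltage z w hg]
      ring) x w
  simp only [voltage_ground, Pi.sub_apply] at this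
  linarith

lemma resistance_eq (z x y : Γ.Point) :
    Γ.resistance x y = Γ.resistance z x + Γ.resistance z y - 2 * Γ.voltage z x y := by
  rw [resistance, resistance, resistance, voltage_change_ground z x y y, voltage_symm z y x]
  ring

lemma resistance_self (x : Γ.Point) : Γ.resistance x x = 0 := voltage_ground x x

lemma resistance_symm (x y : Γ.Point) : Γ.resistance x y = Γ.resistance y x := by
  rw [resistance_eq y x y, resistance_self, voltage_symm, voltage_ground, add_zero, mul_zero,
    sub_zero]

lemma energy_voltage_self (x y : Γ.Point) :
    energy 1 (fun w => Γ.voltage x w y) (fun w => Γ.voltage x w y) = Γ.resistance x y := by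
  rw [energy_voltage x y (voltage_mem_piecewisePoly x y), voltage_ground, sub_zero, resistance]

lemma resistance_nonneg (x y : Γ.Point) : 0 ≤ Γ.resistance x y :=
  energy_voltage_self x y ▸ energy_self_nonneg _

open Classical in
lemma resistance_pos (h : x ≠ y) : 0 < Γ.resistance x y := by
  refine (resistance_nonneg x y).lt_of_ne fun h0 => ?_
  have voltage_const (w) : Γ.voltage x w y = 0 :=
    (eq_of_energy_self_eq_zero (voltage_mem_piecewisePoly x y)
      (by rw [energy_voltage_self, ← h0]) w x).trans (voltage_ground x y)
  obtain ⟨g, hg, hw⟩ := exists_affineOff_eq (V := Γ.branch ∪ {x, y}) Finset.subset_union_left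
    fun w => if w = y then 1 else 0
  have := energy_voltage x y hg.polyOff.mem_piecewisePoly
  simp only [voltage_const, energy_const_left] at this
  rw [hw x (by simp), hw y (by simp), if_pos rfl, if_neg h, sub_zero] at this
  exact zero_ne_one this

lemma resistance_le (z x y : Γ.Point) :
    Γ.resistance x y ≤ 2 * (Γ.resistance z x + Γ.resistance z y) := by
  have hx := voltage_mem_piecewisePoly z x
  have hy := voltage_mem_piecewisePoly z y
  have energy_nonneg := energy_self_nonneg ((fun w => Γ.voltage z w x) + fun w => Γ.voltage z w y)
  rw [energy_add_left continuous_one hx hy (add_mem hx hy), energy_voltage z x (add_mem hx hy),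
    energy_voltage z y (add_mem hx hy)] at energy_nonneg
  simp only [Pi.add_apply, voltage_ground, voltage_symm z y x] at energy_nonneg
  have := resistance_eq z x y
  simp only [resistance] at this ⊢
  linarith

end Voltage

section Resistance

variable [DecidableEq Γ.Point] {y : Γ.Point} {e : Γ.Edge} {a b s t : ℝ}

lemma affineAt_voltage_path (hs : s ∈ Set.Icc 0 (Γ.len e)) (ht : t ∈ Set.Icc 0 (Γ.len e))
    (hsy : Γ.path e s ∉ Γ.branch ∪ {y}) (hst : s ≠ t) :
    AffineAt (fun s => Γ.voltage y (Γ.path e s) (Γ.path e t)) s := by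
  simp only [Finset.mem_union, Finset.mem_singleton, not_or] at hsy
  refine (affineOff_voltage y (Γ.path e t)).affineAt e s (mem_Ioo_of_path_notMem_branch hs hsy.1) ?_
  simp only [Finset.mem_union, Finset.mem_insert, Finset.mem_singleton, not_or]
  exact ⟨hsy.1, hsy.2, fun h => hst (eq_of_path_eq hs ht h.symm hsy.1).2.symm⟩

/-- The function `j_y(·, x)` with `x = path e t` is affine on `[a, b]` but for a kink at `x`, where
its slope drops by `1`. -/
lemma resistance_path_mul_sub (ha : 0 ≤ a) (hb : b ≤ Γ.len e)
    (hgap : ∀ s ∈ Set.Ioo a b, Γ.path e s ∉ Γ.branch ∪ {y}) (ht : t ∈ Set.Icc a b) :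
    Γ.resistance y (Γ.path e t) * (b - a) =
      Γ.voltage y (Γ.path e t) (Γ.path e a) * (b - t) +
        Γ.voltage y (Γ.path e t) (Γ.path e b) * (t - a) + (t - a) * (b - t) := by
  rcases ht.1.eq_or_lt with rfl | hat
  · simp [resistance]
  rcases ht.2.eq_or_lt with rfl | htb
  · simp [resistance]
  have mem_Icc {s} (hs : s ∈ Set.Icc a b) : s ∈ Set.Icc 0 (Γ.len e) :=
    ⟨ha.trans hs.1, hs.2.trans hb⟩
  have hty := hgap t ⟨hat, htb⟩
  simp only [Finset.mem_union, Finset.mem_singleton, not_or] at hty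
  have kink := (isVoltage_voltage y (Γ.path e t)).slopeSum_eq (Γ.path e t)
  rw [slopeSum_path (mem_Icc ht) hty.1, if_neg hty.2, if_pos rfl, zero_sub] at kink
  have := mul_sub_eq_of_forall_affineAt_of_ne (((isVoltage_voltage y (Γ.path e t)).continuous.comp
    (continuous_path e)).continuousOn) ht fun s hs hst =>
      affineAt_voltage_path (mem_Icc (Set.Ioo_subset_Icc_self hs)) (mem_Icc ht) (hgap s hs) hst
  simp only [Function.comp_apply, Function.comp_def, kink] at this
  rw [resistance, this, voltage_symm y (Γ.path e a), voltage_symm y (Γ.path e b)]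
  ring

open Polynomial in
lemma exists_eqOn_polynomial_resistance (ha : 0 ≤ a) (hab : a < b) (hb : b ≤ Γ.len e)
    (hgap : ∀ s ∈ Set.Ioo a b, Γ.path e s ∉ Γ.branch ∪ {y}) :
    ∃ P : ℝ[X],
      Set.EqOn (fun t => Γ.resistance y (Γ.path e t)) (fun t => P.eval t) (Set.Icc a b) := by
  have voltage_eqOn {c} (hc : c ∈ Set.Icc 0 (Γ.len e)) (hcab : c ∉ Set.Ioo a b) : ∃ P : ℝ[X],
      Set.EqOn (fun t => Γ.voltage y (Γ.path e t) (Γ.path e c)) (fun t => P.eval t)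
        (Set.Icc a b) :=
    exists_eqOn_polynomial_of_forall_polyAt hab
      ((isVoltage_voltage y (Γ.path e c)).continuous.comp (continuous_path e)).continuousOn
      fun s hs => (affineAt_voltage_path ⟨ha.trans hs.1.le, hs.2.le.trans hb⟩ hc (hgap s hs)
        fun h => hcab (h ▸ hs)).polyAt
  obtain ⟨P, hP⟩ := voltage_eqOn ⟨ha, hab.le.trans hb⟩ Set.left_notMem_Ioo
  obtain ⟨Q, hQ⟩ := voltage_eqOn ⟨ha.trans hab.le, hb⟩ Set.right_notMem_Ioo
  refine ⟨C (b - a)⁻¹ * (P * (C b - X) + Q * (X - C a) + (X - C a) * (C b - X)), fun t ht => ?_⟩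
  have hP := hP ht
  have hQ := hQ ht
  simp only at hP hQ ⊢
  simp only [eval_mul, eval_add, eval_sub, eval_C, eval_X, ← hP, ← hQ]
  rw [← resistance_path_mul_sub ha hb hgap ht, mul_comm, mul_inv_cancel_right₀ (sub_pos.2 hab).ne']

lemma polyOff_resistance (y : Γ.Point) : PolyOff (Γ.branch ∪ {y}) (Γ.resistance y) := by
  have polynomial_on_gap (e) (c d : ℝ) (hc : 0 ≤ c) (hcd : c < d) (hd : d ≤ Γ.len e)
      (hgap : ∀ t ∈ breaks (Γ.branch ∪ {y}) e, t ∉ Set.Ioo c d) :=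
    exists_eqOn_polynomial_resistance hc hcd hd fun s hs hsy =>
      hgap s (mem_breaks.2 ⟨⟨hc.trans hs.1.le, hs.2.le.trans hd⟩, hsy⟩) hs
  refine ⟨continuous_of_forall_path fun e => ?_, fun e t ht hty => ?_⟩
  · exact continuousOn_Icc_of_forall_gap _ (Γ.len_pos e) (polynomial_on_gap e)
  · exact polyAt_of_forall_gap _ (Γ.len_pos e) (polynomial_on_gap e) t ht
      fun h => hty (mem_breaks.1 h).2

end Resistance

open Classical in
lemma resistance_mem_piecewisePoly (y : Γ.Point) : Γ.resistance y ∈ Γ.piecewisePoly :=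
  (polyOff_resistance y).mem_piecewisePoly

lemma continuous_resistance (y : Γ.Point) : Continuous (Γ.resistance y) :=
  continuous_of_mem_piecewisePoly (resistance_mem_piecewisePoly y)

variable (Γ) in
lemma exists_forall_norm_resistance_le : ∃ C, ∀ x y, ‖Γ.resistance x y‖ ≤ C := by
  obtain ⟨z⟩ : Nonempty Γ.Point := inferInstance
  obtain ⟨C, hC⟩ := (isCompact_range (continuous_resistance z)).bddAbove
  refine ⟨2 * (C + C), fun x y => ?_⟩
  rw [Real.norm_of_nonneg (resistance_nonneg x y)]
  exact (resistance_le z x y).trans (by gcongr <;> exact hC ⟨_, rfl⟩)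

end MetrizedGraph

section SignedMeasure

variable {X Y : Type*} [MeasurableSpace X] [MeasurableSpace Y]

lemma isFiniteMeasure_variation (μ : SignedMeasure X) : IsFiniteMeasure μ.variation := by
  rw [← SignedMeasure.totalVariation_eq_variation]
  infer_instance

lemma integral_smul_toSignedMeasure (μ : Measure X) [IsFiniteMeasure μ] (f : X → ℝ) :
    ∫ᵛ x, f x ∂•μ.toSignedMeasure = ∫ x, f x ∂μ := by
  have flip_lsmul : ContinuousLinearMap.lsmul ℝ ℝ (E := ℝ) =
      (ContinuousLinearMap.lsmul ℝ ℝ (E := ℝ)).flip := by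
    ext
    simp
  rw [flip_lsmul, VectorMeasure.integral_toSignedMeasure]

lemma integral_toSignedMeasure_sub {α β : Measure X} [IsFiniteMeasure α] [IsFiniteMeasure β]
    {f : X → ℝ} (hα : Integrable f α) (hβ : Integrable f β) :
    ∫ᵛ x, f x ∂•(α.toSignedMeasure - β.toSignedMeasure) = ∫ x, f x ∂α - ∫ x, f x ∂β := by
  rw [VectorMeasure.integral_sub_vectorMeasure, integral_smul_toSignedMeasure,
    integral_smul_toSignedMeasure] <;>
  simpa only [VectorMeasure.Integrable, Measure.variation_toSignedMeasure]

lemma integral_signedMeasure (μ : SignedMeasure X) {f : X → ℝ} (hf : μ.Integrable f) :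
    ∫ᵛ x, f x ∂•μ = ∫ x, f x ∂μ.toJordanDecomposition.posPart -
      ∫ x, f x ∂μ.toJordanDecomposition.negPart := by
  rw [VectorMeasure.Integrable, ← SignedMeasure.totalVariation_eq_variation,
    SignedMeasure.totalVariation, integrable_add_measure] at hf
  conv_lhs => rw [← μ.toSignedMeasure_toJordanDecomposition]
  exact integral_toSignedMeasure_sub hf.1 hf.2

lemma integral_withDensityᵥ {μ : Measure X} {w g : X → ℝ} (hw : Integrable w μ)
    (hg : AEStronglyMeasurable g μ) {C : ℝ} (hC : ∀ x, ‖g x‖ ≤ C) :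
    ∫ᵛ x, g x ∂•μ.withDensityᵥ w = ∫ x, w x * g x ∂μ := by
  have := isFiniteMeasure_withDensity_ofReal hw.2
  have := isFiniteMeasure_withDensity_ofReal hw.neg.2
  have integrable_withDensity : ∀ v : X → ℝ,
      IsFiniteMeasure (μ.withDensity fun x => ENNReal.ofReal (v x)) →
      Integrable g (μ.withDensity fun x => ENNReal.ofReal (v x)) := fun v _ =>
    .of_bound (hg.mono_ac (withDensity_absolutelyContinuous _ _)) C (.of_forall hC)
  have integral_withDensity : ∀ v : X → ℝ, Integrable v μ →
      ∫ x, g x ∂μ.withDensity (fun x => ENNReal.ofReal (v x)) = ∫ x, max (v x) 0 * g x ∂μ := by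
    intro v hv
    rw [integral_withDensity_eq_integral_toReal_smul₀ hv.1.aemeasurable.ennreal_ofReal
      (.of_forall fun _ => ENNReal.ofReal_lt_top)]
    simp only [ENNReal.toReal_ofReal', smul_eq_mul]
  rw [withDensityᵥ_eq_withDensity_pos_part_sub_withDensity_neg_part hw,
    integral_toSignedMeasure_sub (integrable_withDensity _ ‹_›) (integrable_withDensity _ ‹_›),
    integral_withDensity _ hw, integral_withDensity (fun x => -w x) hw.neg,
    ← integral_sub (hw.pos_part.mul_bdd hg (.of_forall hC))
      (hw.neg_part.mul_bdd hg (.of_forall hC))]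
  simp only [← sub_mul, max_zero_sub_max_neg_zero_eq_self]

lemma integrable_signedMeasure_of_continuous [TopologicalSpace X] [CompactSpace X]
    [OpensMeasurableSpace X] {f : X → ℝ} (hf : Continuous f) (μ : SignedMeasure X) :
    μ.Integrable f := by
  have := isFiniteMeasure_variation μ
  exact Continuous.integrable_of_hasCompactSupport hf (.of_compactSpace f)

section Fubini

variable {k : X → Y → ℝ} {C : ℝ}

lemma integral_integral_signedMeasure_swap (hk : Measurable (Function.uncurry k))
    (hC : ∀ x y, ‖k x y‖ ≤ C) (α : Measure X) [IsFiniteMeasure α] (ν : SignedMeasure Y) :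
    ∫ x, ∫ᵛ y, k x y ∂•ν ∂α = ∫ᵛ y, ∫ x, k x y ∂α ∂•ν := by
  have := isFiniteMeasure_variation ν
  have integrable_uncurry : ∀ (β : Measure Y) [IsFiniteMeasure β],
      Integrable (Function.uncurry k) (α.prod β) := fun β _ =>
    .of_bound hk.aestronglyMeasurable C (.of_forall fun p => hC p.1 p.2)
  have integrable_left : ∀ (β : Measure Y) [IsFiniteMeasure β],
      Integrable (fun x => ∫ y, k x y ∂β) α := fun β _ =>
    (integrable_uncurry β).integral_prod_left
  have integrable_right : ν.Integrable fun y => ∫ x, k x y ∂α :=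
    (integrable_uncurry ν.variation).integral_prod_right
  have integrable_section : ∀ x, ν.Integrable (k x) := fun x =>
    Integrable.of_bound hk.of_uncurry_left.aestronglyMeasurable C (.of_forall (hC x))
  rw [integral_signedMeasure ν integrable_right]
  simp only [integral_signedMeasure ν (integrable_section _)]
  rw [integral_sub (integrable_left _) (integrable_left _),
    integral_integral_swap (integrable_uncurry _), integral_integral_swap (integrable_uncurry _)]

lemma integral_signedMeasure_integral_swap (hk : Measurable (Function.uncurry k))
    (hC : ∀ x y, ‖k x y‖ ≤ C) (μ : SignedMeasure X) (ν : SignedMeasure Y) :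
    ∫ᵛ x, ∫ᵛ y, k x y ∂•ν ∂•μ = ∫ᵛ y, ∫ᵛ x, k x y ∂•μ ∂•ν := by
  have := isFiniteMeasure_variation μ
  have := isFiniteMeasure_variation ν
  have integrable_left : ∀ (β : Measure Y) [IsFiniteMeasure β],
      μ.Integrable fun x => ∫ y, k x y ∂β := fun β _ =>
    Integrable.integral_prod_left (f := Function.uncurry k) (μ := μ.variation)
      (.of_bound hk.aestronglyMeasurable C (.of_forall fun p => hC p.1 p.2))
  have integrable_right : ∀ (α : Measure X) [IsFiniteMeasure α],
      ν.Integrable fun y => ∫ x, k x y ∂α := fun α _ =>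
    Integrable.integral_prod_right (f := Function.uncurry k) (ν := ν.variation)
      (.of_bound hk.aestronglyMeasurable C (.of_forall fun p => hC p.1 p.2))
  have integrable_section_left : ∀ y, μ.Integrable fun x => k x y := fun y =>
    Integrable.of_bound hk.of_uncurry_right.aestronglyMeasurable C (.of_forall (hC · y))
  have integrable_section_right : ∀ x, ν.Integrable (k x) := fun x =>
    Integrable.of_bound hk.of_uncurry_left.aestronglyMeasurable C (.of_forall (hC x))
  have integrable_integral : μ.Integrable fun x => ∫ᵛ y, k x y ∂•ν := by
    simp only [integral_signedMeasure ν (integrable_section_right _)]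
    exact (integrable_left _).fun_sub (integrable_left _)
  rw [integral_signedMeasure μ integrable_integral,
    integral_integral_signedMeasure_swap hk hC, integral_integral_signedMeasure_swap hk hC,
    ← VectorMeasure.integral_fun_sub (integrable_right _) (integrable_right _)]
  simp only [integral_signedMeasure μ (integrable_section_left _)]

end Fubini

end SignedMeasure

namespace MetrizedGraph

variable {Γ : MetrizedGraph.{u}}

section CanonicalMeasure

variable {V : Finset Γ.Point} {f g : Γ.Point → ℝ}

/-- The Laplacian `Δ f = -f'' dx - ∑ₓ (slopeSum f x) δₓ` as a signed measure. The finite set `V`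
is to contain the branch points and the points off which `f` is smooth. -/
def laplacian (V : Finset Γ.Point) (f : Γ.Point → ℝ) : SignedMeasure Γ.Point :=
  ∑ e, ((volume.restrict (Set.Ioc 0 (Γ.len e))).withDensityᵥ
      fun t => -deriv (deriv fun s => f (Γ.path e s)) t).map (Γ.path e) +
    ∑ x ∈ V, VectorMeasure.dirac x (-Γ.slopeSum f x)

lemma integral_map_path {e : Γ.Edge} {w : ℝ → ℝ} (hw : IntervalIntegrable w volume 0 (Γ.len e))
    (hg : Continuous g) :
    ∫ᵛ x, g x ∂•((volume.restrict (Set.Ioc 0 (Γ.len e))).withDensityᵥ w).map (Γ.path e) =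
      ∫ t in 0..Γ.len e, w t * g (Γ.path e t) := by
  obtain ⟨C, hC⟩ := (isCompact_range hg).isBounded.exists_norm_le
  have hC (x : Γ.Point) : ‖g x‖ ≤ C := hC _ ⟨x, rfl⟩
  have hgm : AEStronglyMeasurable (fun t => g (Γ.path e t)) :=
    (hg.comp (continuous_path e)).aestronglyMeasurable
  have := isFiniteMeasure_variation ((volume.restrict (Set.Ioc 0 (Γ.len e))).withDensityᵥ w)
  rw [VectorMeasure.integral_map (continuous_path e).measurable
      hg.measurable.aestronglyMeasurable (.of_bound
      (hg.comp (continuous_path e)).aestronglyMeasurable C (.of_forall fun _ => hC _)),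
    integral_withDensityᵥ hw.1 hgm.restrict fun _ => hC _,
    intervalIntegral.integral_of_le (Γ.len_pos e).le]

lemma integral_laplacian_of_continuous (hf : PolyOff V f) (hg : Continuous g) :
    ∫ᵛ x, g x ∂•laplacian V f =
      -(∑ e, ∫ t in 0..Γ.len e, deriv (deriv fun s => f (Γ.path e s)) t * g (Γ.path e t)) -
        ∑ x ∈ V, Γ.slopeSum f x * g x := by
  classical
  have integrable (μ : SignedMeasure Γ.Point) := integrable_signedMeasure_of_continuous hg μ
  rw [laplacian, VectorMeasure.integral_add_vectorMeasure (integrable _) (integrable _),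
    VectorMeasure.integral_finsetSum_vectorMeasure fun _ _ => integrable _,
    VectorMeasure.integral_finsetSum_vectorMeasure fun _ _ => integrable _, sub_eq_add_neg,
    ← Finset.sum_neg_distrib, ← Finset.sum_neg_distrib]
  congr 1
  · refine Finset.sum_congr rfl fun e _ => ?_
    have hw := (hf.piecewisePoly_path e).intervalIntegrable_deriv_deriv (Γ.len_pos e)
    rw [integral_map_path (w := fun t => -deriv _ t) hw.neg hg, ← intervalIntegral.integral_neg]
    simp only [neg_mul]
  · refine Finset.sum_congr rfl fun x _ => ?_
    rw [VectorMeasure.integral_dirac' hg.measurable.stronglyMeasurable]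
    simp [mul_comm]

lemma integral_laplacian (hV : Γ.branch ⊆ V) (hf : PolyOff V f) (hg : g ∈ Γ.piecewisePoly) :
    ∫ᵛ x, g x ∂•laplacian V f = energy 1 f g := by
  classical
  obtain ⟨W, hW⟩ := id hg
  have green := energy_add_integral_deriv_deriv_mul (hV.trans Finset.subset_union_left)
    (hf.mono (Finset.subset_union_left (s₂ := W))) (hW.mono (Finset.subset_union_right (s₁ := V)))
  rw [← Finset.sum_subset (Finset.subset_union_left (s₁ := V) (s₂ := W))
    fun x _ hx => by rw [hf.slopeSum_eq_zero hV hx, zero_mul]] at green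
  rw [integral_laplacian_of_continuous hf (continuous_of_mem_piecewisePoly hg)]
  linarith

open Classical in
/-- The canonical measure `δ_y + ½ Δ_x r(x, y)`, for an arbitrary base point `y`. -/
def canonicalMeasure (y : Γ.Point) : SignedMeasure Γ.Point :=
  VectorMeasure.dirac y 1 + (1 / 2 : ℝ) • laplacian (Γ.branch ∪ {y}) (Γ.resistance y)

lemma integral_canonicalMeasure (y : Γ.Point) (hg : g ∈ Γ.piecewisePoly) :
    ∫ᵛ x, g x ∂•canonicalMeasure y = g y + 1 / 2 * energy 1 (Γ.resistance y) g := by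
  classical
  have hgc := continuous_of_mem_piecewisePoly hg
  have integrable (μ : SignedMeasure Γ.Point) := integrable_signedMeasure_of_continuous hgc μ
  rw [canonicalMeasure, VectorMeasure.integral_add_vectorMeasure (integrable _) (integrable _),
    VectorMeasure.integral_dirac' hgc.measurable.stronglyMeasurable,
    VectorMeasure.integral_smul_vectorMeasure,
    integral_laplacian Finset.subset_union_left (polyOff_resistance y) hg]
  simp

lemma energy_resistance_resistance (x y : Γ.Point) :
    energy 1 (Γ.resistance y) (Γ.resistance x) =
      energy 1 (Γ.resistance y) (Γ.resistance y) - 2 * Γ.resistance x y := by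
  have hr := resistance_mem_piecewisePoly y
  have hj := voltage_mem_piecewisePoly y x
  have hc : (fun _ => Γ.resistance y x) ∈ Γ.piecewisePoly := Subalgebra.algebraMap_mem _ _
  have resistance_eq_sub : Γ.resistance x =
      ((fun _ => Γ.resistance y x) + Γ.resistance y) - (2 : ℝ) • fun z => Γ.voltage y z x := by
    ext z
    simp [resistance_eq y x z, voltage_symm y x z]
  calc energy 1 (Γ.resistance y) (Γ.resistance x)
      = energy 1 (((fun _ => Γ.resistance y x) + Γ.resistance y) -
          (2 : ℝ) • fun z => Γ.voltage y z x) (Γ.resistance y) := by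
        rw [energy_comm, ← resistance_eq_sub]
    _ = energy 1 (Γ.resistance y) (Γ.resistance y) - 2 * Γ.resistance x y := by
        rw [energy_sub_left continuous_one (add_mem hc hr) (Γ.piecewisePoly.smul_mem hj 2) hr,
          energy_add_left continuous_one hc hr hr, energy_const_left, energy_smul_left,
          energy_voltage y x hr, resistance_self, resistance_symm x y]
        ring

lemma measureVoltage_self (μ : SignedMeasure Γ.Point) (x : Γ.Point) :
    Γ.measureVoltage μ x x = ∫ᵛ ζ, Γ.resistance x ζ ∂•μ := by
  simp only [resistance_symm x]
  rfl

lemma measureVoltage_canonicalMeasure (x y : Γ.Point) :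
    Γ.measureVoltage (canonicalMeasure y) x x =
      1 / 2 * energy 1 (Γ.resistance y) (Γ.resistance y) := by
  rw [measureVoltage_self, integral_canonicalMeasure y (resistance_mem_piecewisePoly x),
    energy_resistance_resistance]
  ring

lemma isCanonicalMeasure_canonicalMeasure (y : Γ.Point) :
    Γ.IsCanonicalMeasure (canonicalMeasure y) := by
  have := isFiniteMeasure_variation (canonicalMeasure y)
  refine ⟨?_, fun x x' => by simp only [measureVoltage_canonicalMeasure]⟩
  calc canonicalMeasure y Set.univ = ∫ᵛ _, (1 : ℝ) ∂•canonicalMeasure y := by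
        simp [VectorMeasure.integral_const]
    _ = 1 + 1 / 2 * energy 1 (fun _ => 1) (Γ.resistance y) := by
        rw [energy_comm]
        exact integral_canonicalMeasure y (one_mem Γ.piecewisePoly)
    _ = 1 := by rw [energy_const_left, mul_zero, add_zero]

instance : TopologicalSpace.SeparableSpace Γ.Point :=
  Γ.proj_surjective.denseRange.separableSpace Γ.continuous_proj

instance : TopologicalSpace.MetrizableSpace Γ.Point := by
  refine Metric.PiNatEmbed.TopologicalSpace.MetrizableSpace.of_countable_separating
    (fun n => Γ.resistance (TopologicalSpace.denseSeq Γ.Point n))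
    (fun n => continuous_resistance _) fun x y hxy => ?_
  by_contra! h
  have resistance_eq_resistance : Γ.resistance x = Γ.resistance y := by
    refine Continuous.ext_on (TopologicalSpace.denseRange_denseSeq Γ.Point)
      (continuous_resistance x) (continuous_resistance y) ?_
    rintro _ ⟨n, rfl⟩
    rw [resistance_symm x, resistance_symm y, h n]
  have := congrFun resistance_eq_resistance x
  rw [resistance_self] at this
  exact (resistance_pos hxy.symm).ne this

variable (Γ) in
lemma measurable_uncurry_resistance : Measurable (Function.uncurry Γ.resistance) := by
  have : Function.uncurry Γ.resistance = Function.uncurry fun x y => Γ.resistance y x := by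
    ext p
    exact resistance_symm p.1 p.2
  rw [this]
  exact measurable_uncurry_of_continuous_of_measurable
    (fun y => continuous_resistance y) fun x => by
      simpa only [resistance_symm _ x] using (continuous_resistance x).measurable

lemma IsCanonicalMeasure.measureVoltage_eq {μ ν : SignedMeasure Γ.Point}
    (hμ : Γ.IsCanonicalMeasure μ) (hν : Γ.IsCanonicalMeasure ν) (x : Γ.Point) :
    Γ.measureVoltage μ x x = Γ.measureVoltage ν x x := by
  have := isFiniteMeasure_variation μ
  have := isFiniteMeasure_variation ν
  obtain ⟨C, hC⟩ := Γ.exists_forall_norm_resistance_le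
  calc Γ.measureVoltage μ x x = ∫ᵛ y, Γ.measureVoltage μ y y ∂•ν := by
        simp [hμ.2 _ x, VectorMeasure.integral_const, hν.1]
    _ = ∫ᵛ y, Γ.measureVoltage ν y y ∂•μ := by
        simp only [measureVoltage_self]
        rw [integral_signedMeasure_integral_swap Γ.measurable_uncurry_resistance hC]
        simp only [resistance_symm]
    _ = Γ.measureVoltage ν x x := by simp [hν.2 _ x, VectorMeasure.integral_const, hμ.1]

theorem tau_eq (y : Γ.Point) :
    Γ.tau = 1 / 4 * energy 1 (Γ.resistance y) (Γ.resistance y) := by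
  have hy := isCanonicalMeasure_canonicalMeasure y
  have h : ∃ c, ∃ μ, Γ.IsCanonicalMeasure μ ∧ ∀ x, 1 / 2 * Γ.measureVoltage μ x x = c :=
    ⟨_, _, hy, fun x => by rw [hy.2 x y]⟩
  obtain ⟨μ, hμ, tau_eq⟩ := h.choose_spec
  rw [tau, dif_pos h, ← tau_eq y, hμ.measureVoltage_eq hy, measureVoltage_canonicalMeasure]
  ring

end CanonicalMeasure

section EnergyIdentities

variable {f g h : Γ.Point → ℝ}

lemma energy_pow_left (hh : Continuous h) (hf : f ∈ Γ.piecewisePoly) (hg : g ∈ Γ.piecewisePoly)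
    (n : ℕ) : energy h (f ^ (n + 1)) g = (n + 1) * energy (h * f ^ n) f g := by
  induction n generalizing h with
  | zero => simp
  | succ n ih =>
    have hfc := continuous_of_mem_piecewisePoly hf
    rw [pow_succ, energy_mul_left hh (pow_mem hf _) hf hg, ih (hh.mul hfc), mul_assoc h,
      ← pow_succ', Nat.cast_succ]
    ring

lemma energy_sub_smul_self (hh : Continuous h) (hf : f ∈ Γ.piecewisePoly)
    (hg : g ∈ Γ.piecewisePoly) (c : ℝ) :
    energy h (f - c • g) (f - c • g) =
      energy h f f - 2 * c * energy h f g + c ^ 2 * energy h g g := by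
  have hcg := Γ.piecewisePoly.smul_mem hg c
  have hsub := sub_mem hf hcg
  rw [energy_sub_left hh hf hcg hsub, energy_smul_left, energy_comm h f, energy_comm h g,
    energy_sub_left hh hf hcg hf, energy_sub_left hh hf hcg hg, energy_smul_left,
    energy_smul_left, energy_comm h g f]
  ring

variable (p q : Γ.Point)

lemma energy_voltage_pow (n : ℕ) :
    (n + 1) * energy ((fun x => Γ.voltage p x q) ^ n) (fun x => Γ.voltage p x q)
      (fun x => Γ.voltage p x q) = Γ.resistance p q ^ (n + 1) := by
  have hu := voltage_mem_piecewisePoly p q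
  rw [← one_mul ((fun x => Γ.voltage p x q) ^ n), ← energy_pow_left continuous_one hu hu,
    energy_comm, energy_voltage p q (pow_mem hu _)]
  simp [voltage_ground, resistance]

lemma A_eq :
    Γ.A p q = energy (Γ.resistance p) (fun x => Γ.voltage p x q) (fun x => Γ.voltage p x q) -
      Γ.resistance p q ^ 2 / 2 := by
  have hu := voltage_mem_piecewisePoly p q
  have voltage_eq (x : Γ.Point) :
      Γ.voltage x p q = Γ.resistance p x + (-1 : ℝ) * Γ.voltage p x q := by
    linarith [Γ.resistance_eq x p q, Γ.resistance_eq p x q, Γ.resistance_symm x p]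
  have A_eq_energy : Γ.A p q =
      energy (Γ.resistance p + (-1 : ℝ) • fun x => Γ.voltage p x q) (fun x => Γ.voltage p x q)
        (fun x => Γ.voltage p x q) := by
    simp only [A, energy, voltage_eq, sq, Pi.add_apply, Pi.smul_apply, smul_eq_mul]
  have energy_self := energy_voltage_pow p q 1
  rw [pow_one] at energy_self
  rw [A_eq_energy, energy_add_weight (continuous_resistance p)
    ((continuous_of_mem_piecewisePoly hu).const_smul _) hu hu, energy_smul_weight]
  push_cast at energy_self
  linarith

lemma energy_voltage_resistance_voltage :
    energy (fun x => Γ.voltage p x q) (Γ.resistance p) (fun x => Γ.voltage p x q) =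
      Γ.resistance p q ^ 2 / 2 - Γ.A p q := by
  have hu := voltage_mem_piecewisePoly p q
  have hr := resistance_mem_piecewisePoly p
  have leibniz := energy_mul_left continuous_one hr hu hu
  rw [energy_comm, energy_voltage p q (mul_mem hr hu), one_mul, one_mul] at leibniz
  simp only [Pi.mul_apply, voltage_ground, mul_zero, sub_zero] at leibniz
  rw [A_eq]
  change Γ.resistance p q * Γ.resistance p q = _ at leibniz
  linarith

lemma energy_resistance_sub (c : ℝ) :
    energy 1 (Γ.resistance p - c • (fun x => Γ.voltage p x q) ^ 2)
        (Γ.resistance p - c • (fun x => Γ.voltage p x q) ^ 2) =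
      4 * Γ.tau - 4 * c * (Γ.resistance p q ^ 2 / 2 - Γ.A p q)
        + 4 / 3 * c ^ 2 * Γ.resistance p q ^ 3 := by
  have hu := voltage_mem_piecewisePoly p q
  have hr := resistance_mem_piecewisePoly p
  have hu2 := pow_mem hu 2
  have hu' := continuous_of_mem_piecewisePoly hu
  have energy_resistance_sq : energy 1 (Γ.resistance p) ((fun x => Γ.voltage p x q) ^ 2) =
      2 * (Γ.resistance p q ^ 2 / 2 - Γ.A p q) := by
    rw [energy_comm, energy_pow_left continuous_one hu hr, pow_one, one_mul, energy_comm,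
      energy_voltage_resistance_voltage]
    norm_num
  have energy_sq_sq : energy 1 ((fun x => Γ.voltage p x q) ^ 2)
      ((fun x => Γ.voltage p x q) ^ 2) = 4 / 3 * Γ.resistance p q ^ 3 := by
    rw [energy_pow_left continuous_one hu hu2, pow_one, one_mul, energy_comm,
      energy_pow_left hu' hu hu, pow_one, ← sq]
    have energy_sq := energy_voltage_pow p q 2
    push_cast at energy_sq ⊢
    linarith
  rw [energy_sub_smul_self continuous_one hr hu2, energy_resistance_sq, energy_sq_sq, tau_eq p]
  ring

end EnergyIdentities

section Gluing

variable {Γ₁ Γ₂ : MetrizedGraph.{u}}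

/-- The metrized graph `Γ` is obtained from `Γ₁` and `Γ₂` by identifying `p₁` with `p₂` and `q₁`
with `q₂`, as far as piecewise polynomial functions and energies are concerned. This form of the
notion is symmetric in `Γ₁` and `Γ₂`. -/
structure IsGluing (p₁ q₁ : Γ₁.Point) (p₂ q₂ : Γ₂.Point)
    (i₁ : Γ₁.Point → Γ.Point) (i₂ : Γ₂.Point → Γ.Point) : Prop where
  map_p : i₁ p₁ = i₂ p₂
  map_q : i₁ q₁ = i₂ q₂
  comp_left_mem : ∀ f ∈ Γ.piecewisePoly, f ∘ i₁ ∈ Γ₁.piecewisePoly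
  comp_right_mem : ∀ f ∈ Γ.piecewisePoly, f ∘ i₂ ∈ Γ₂.piecewisePoly
  energy_eq : ∀ h f g : Γ.Point → ℝ,
    energy h f g = energy (h ∘ i₁) (f ∘ i₁) (g ∘ i₁) + energy (h ∘ i₂) (f ∘ i₂) (g ∘ i₂)
  exists_comp_eq : ∀ f₁ ∈ Γ₁.piecewisePoly, ∀ f₂ ∈ Γ₂.piecewisePoly, f₁ p₁ = f₂ p₂ → f₁ q₁ = f₂ q₂ →
    ∃ f ∈ Γ.piecewisePoly, f ∘ i₁ = f₁ ∧ f ∘ i₂ = f₂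

variable {p₁ q₁ : Γ₁.Point} {p₂ q₂ : Γ₂.Point}
  {i₁ : Γ₁.Point → Γ.Point} {i₂ : Γ₂.Point → Γ.Point}

lemma IsGluing.symm (h : IsGluing p₁ q₁ p₂ q₂ i₁ i₂) : IsGluing p₂ q₂ p₁ q₁ i₂ i₁ where
  map_p := h.map_p.symm
  map_q := h.map_q.symm
  comp_left_mem := h.comp_right_mem
  comp_right_mem := h.comp_left_mem
  energy_eq k f g := by rw [h.energy_eq, add_comm]
  exists_comp_eq f₁ h₁ f₂ h₂ hp hq := by
    obtain ⟨f, hf, hf₂, hf₁⟩ := h.exists_comp_eq f₂ h₂ f₁ h₁ hp.symm hq.symm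
    exact ⟨f, hf, hf₁, hf₂⟩

lemma IsGluing.resistance_comp_eq (h : IsGluing p₁ q₁ p₂ q₂ i₁ i₂)
    (hR : Γ₁.resistance p₁ q₁ + Γ₂.resistance p₂ q₂ ≠ 0) :
    Γ.resistance (i₁ p₁) ∘ i₁ = Γ₁.resistance p₁ -
      (Γ₁.resistance p₁ q₁ + Γ₂.resistance p₂ q₂)⁻¹ • (fun x => Γ₁.voltage p₁ x q₁) ^ 2 := by
  ext x
  -- The current `c` flows from `q` to `p` through `Γ₂` when unit current enters at `x ∈ Γ₁`.
  set c := (Γ₁.resistance p₁ q₁ + Γ₂.resistance p₂ q₂)⁻¹ * Γ₁.voltage p₁ x q₁ with hc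
  have hv := voltage_mem_piecewisePoly p₁ x
  have hu₁ := Γ₁.piecewisePoly.smul_mem (voltage_mem_piecewisePoly p₁ q₁) c
  have hu₂ := Γ₂.piecewisePoly.smul_mem (voltage_mem_piecewisePoly p₂ q₂) c
  obtain ⟨f, hf, hf₁, hf₂⟩ := h.exists_comp_eq _ (sub_mem hv hu₁) _ hu₂
    (by simp [voltage_ground]) (by
      change Γ₁.voltage p₁ q₁ x - c * Γ₁.resistance p₁ q₁ = c * Γ₂.resistance p₂ q₂
      rw [voltage_symm p₁ q₁ x, hc]
      field_simp
      ring)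
  have energy_eq : ∀ g ∈ Γ.piecewisePoly, energy 1 f g = g (i₁ x) - g (i₁ p₁) := fun g hg => by
    have hg₁ := h.comp_left_mem g hg
    have hg₂ := h.comp_right_mem g hg
    rw [h.energy_eq, hf₁, hf₂, Pi.one_comp, Pi.one_comp,
      energy_sub_left continuous_one hv hu₁ hg₁, energy_smul_left, energy_smul_left,
      energy_voltage p₁ x hg₁, energy_voltage p₁ q₁ hg₁, energy_voltage p₂ q₂ hg₂]
    simp only [Function.comp_apply, h.map_p, h.map_q]
    ring
  have f_apply (y : Γ₁.Point) : f (i₁ y) = Γ₁.voltage p₁ y x - c * Γ₁.voltage p₁ y q₁ :=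
    congrFun hf₁ y
  have voltage_eq := voltage_sub_voltage_eq_of_energy_eq hf energy_eq (i₁ x) (i₁ p₁)
  rw [voltage_ground, sub_zero, f_apply, f_apply, voltage_ground, voltage_ground] at voltage_eq
  change Γ.voltage (i₁ p₁) (i₁ x) (i₁ x) = Γ₁.voltage p₁ x x - _ * Γ₁.voltage p₁ x q₁ ^ 2
  rw [voltage_eq, hc]
  ring

end Gluing

section Union

variable {Γ₁ Γ₂ : MetrizedGraph.{u}} {p₁ q₁ : Γ₁.Point} {p₂ q₂ : Γ₂.Point}

/-- The inclusion of `Γ₁` in the union `Γ₁ ∪ Γ₂` along two points. -/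
def unionInl (h₁ : p₁ ≠ q₁) (h₂ : p₂ ≠ q₂) (x : Γ₁.Point) : (Γ₁.union Γ₂ h₁ h₂).Point :=
  Quotient.mk (unionSetoid Γ₁ Γ₂ h₁ h₂) (.inl x)

/-- The inclusion of `Γ₂` in the union `Γ₁ ∪ Γ₂` along two points. -/
def unionInr (h₁ : p₁ ≠ q₁) (h₂ : p₂ ≠ q₂) (x : Γ₂.Point) : (Γ₁.union Γ₂ h₁ h₂).Point :=
  Quotient.mk (unionSetoid Γ₁ Γ₂ h₁ h₂) (.inr x)

variable (h₁ : p₁ ≠ q₁) (h₂ : p₂ ≠ q₂)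

lemma unionInl_injective : Function.Injective (unionInl h₁ h₂) := by
  intro x y hxy
  rcases Quotient.exact hxy with h | h | h | h | h <;> simp_all

lemma unionInr_injective : Function.Injective (unionInr h₁ h₂) := by
  intro x y hxy
  rcases Quotient.exact hxy with h | h | h | h | h <;> simp_all

lemma continuous_unionInl : Continuous (unionInl h₁ h₂ : Γ₁.Point → (Γ₁.union Γ₂ h₁ h₂).Point) :=
  continuous_of_forall_path fun e =>
    ((Γ₁.union Γ₂ h₁ h₂).continuous_path (Sum.inl e)).continuousOn

lemma continuous_unionInr : Continuous (unionInr h₁ h₂ : Γ₂.Point → (Γ₁.union Γ₂ h₁ h₂).Point) :=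
  continuous_of_forall_path fun e =>
    ((Γ₁.union Γ₂ h₁ h₂).continuous_path (Sum.inr e)).continuousOn

lemma exists_mem_piecewisePoly_union {f₁ : Γ₁.Point → ℝ} {f₂ : Γ₂.Point → ℝ}
    (hf₁ : f₁ ∈ Γ₁.piecewisePoly) (hf₂ : f₂ ∈ Γ₂.piecewisePoly)
    (hp : f₁ p₁ = f₂ p₂) (hq : f₁ q₁ = f₂ q₂) :
    ∃ f ∈ (Γ₁.union Γ₂ h₁ h₂).piecewisePoly,
      f ∘ unionInl h₁ h₂ = f₁ ∧ f ∘ unionInr h₁ h₂ = f₂ := by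
  classical
  obtain ⟨V₁, hV₁⟩ := hf₁
  obtain ⟨V₂, hV₂⟩ := hf₂
  let f : (Γ₁.union Γ₂ h₁ h₂).Point → ℝ := Quotient.lift (Sum.elim f₁ f₂) (by
    rintro a b (rfl | ⟨rfl, rfl⟩ | ⟨rfl, rfl⟩ | ⟨rfl, rfl⟩ | ⟨rfl, rfl⟩)
    exacts [rfl, hp, hp.symm, hq, hq.symm])
  refine ⟨f, ⟨V₁.image (unionInl h₁ h₂) ∪ V₂.image (unionInr h₁ h₂),
    continuous_of_forall_path ?_, ?_⟩, rfl, rfl⟩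
  · rintro (e | e)
    · exact (hV₁.continuous.comp (continuous_path e)).continuousOn
    · exact (hV₂.continuous.comp (continuous_path e)).continuousOn
  · rintro (e | e) t ht htV
    · exact hV₁.polyAt e t ht fun h =>
        htV (Finset.mem_union_left _ (Finset.mem_image_of_mem (unionInl h₁ h₂) h))
    · exact hV₂.polyAt e t ht fun h =>
        htV (Finset.mem_union_right _ (Finset.mem_image_of_mem (unionInr h₁ h₂) h))

lemma isGluing_union : IsGluing p₁ q₁ p₂ q₂ (unionInl h₁ h₂) (unionInr h₁ h₂) where
  map_p := Quotient.sound (.inr (.inl ⟨rfl, rfl⟩))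
  map_q := Quotient.sound (.inr (.inr (.inr (.inl ⟨rfl, rfl⟩))))
  comp_left_mem f := by
    rintro ⟨V, hV⟩
    exact ⟨V.preimage _ (unionInl_injective h₁ h₂).injOn,
      hV.continuous.comp (continuous_unionInl h₁ h₂), fun e t ht htV =>
        hV.polyAt (Sum.inl e) t ht fun h => htV (Finset.mem_preimage.2 h)⟩
  comp_right_mem f := by
    rintro ⟨V, hV⟩
    exact ⟨V.preimage _ (unionInr_injective h₁ h₂).injOn,
      hV.continuous.comp (continuous_unionInr h₁ h₂), fun e t ht htV =>
        hV.polyAt (Sum.inr e) t ht fun h => htV (Finset.mem_preimage.2 h)⟩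
  energy_eq h f g := Fintype.sum_sum_type _
  exists_comp_eq f₁ hf₁ f₂ hf₂ hp hq := exists_mem_piecewisePoly_union h₁ h₂ hf₁ hf₂ hp hq

end Union

end MetrizedGraph

end

theorem mainTheorem2 (Γ₁ Γ₂ : MetrizedGraph.{u}) {p₁ q₁ : Γ₁.Point} {p₂ q₂ : Γ₂.Point}
    (h₁ : p₁ ≠ q₁) (h₂ : p₂ ≠ q₂) :
    (Γ₁.union Γ₂ h₁ h₂).tau = Γ₁.tau + Γ₂.tau
      - (Γ₁.resistance p₁ q₁ + Γ₂.resistance p₂ q₂) / 6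
      + (Γ₁.A p₁ q₁ + Γ₂.A p₂ q₂) / (Γ₁.resistance p₁ q₁ + Γ₂.resistance p₂ q₂) := by
  have hglue := MetrizedGraph.isGluing_union h₁ h₂
  have hR : Γ₁.resistance p₁ q₁ + Γ₂.resistance p₂ q₂ ≠ 0 :=
    (add_pos (MetrizedGraph.resistance_pos h₁) (MetrizedGraph.resistance_pos h₂)).ne'
  have resistance_left := hglue.resistance_comp_eq hR
  have resistance_right := hglue.symm.resistance_comp_eq (by rwa [add_comm])
  rw [← hglue.map_p, add_comm (Γ₂.resistance p₂ q₂)] at resistance_right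
  rw [MetrizedGraph.tau_eq (MetrizedGraph.unionInl h₁ h₂ p₁), hglue.energy_eq, resistance_left,
    resistance_right, Pi.one_comp, Pi.one_comp, MetrizedGraph.energy_resistance_sub,
    MetrizedGraph.energy_resistance_sub]
  field_simp
  ring
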